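/- Let $\mathfrak g$ be a finite-dimensional complex semisimple Lie algebra with a triangular decomposition $\mathfrak g=\mathfrak n_-\oplus\mathfrak h\oplus\mathfrak n_+$, given by a Cartan subalgebra $\mathfrak h$ and a base of its root system. For $\lambda,\mu\in\mathfrak h^*$ write $\lambda\leqslant\mu$ if $\mu-\lambda$ is a sum of finitely many (possibly zero) positive roots. A weight module is a $\mathfrak g$-module $M$ that is the direct sum of its weight spaces $M_\mu=\{m\in M : hm=\mu(h)m \text{ for all } h\in\mathfrak h\}$, $\mu\in\mathfrak h^*$. - $\mathcal O$ is the category of weight modules that are finitely generated over $U(\mathfrak n_-)$. - $\widetilde{\mathcal O}$ is the category of weight modules $M$ with $\dim M_\mu<\infty$ for all $\mu$ for which there are $\lambda_1,\dots,\lambda_k\in\mathfrak h^*$ such that every $\mu$ with $M_\mu\neq 0$ satisfies $\mu\leqslant\lambda_i$ for some $i$. - $\mathcal F(\Delta)$ is the category of modules $M\in\mathcal O$ that have a Verma filtration, that is, a finite chain of submodules $0=M_0\subseteq M_1\subseteq\dots\subseteq M_k=M$ such that each $M_i/M_{i-1}$ is isomorphic to a Verma module $\Delta(\mu_i)$, $\mu_i\in\mathfrak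 h^*$. - For a weight module $N$, $N^*=\bigoplus_{\mu}\operatorname{Hom}_{\mathbb C}(N_\mu,\mathbb C)$ is the restricted dual, with $\mathfrak g$-action $(xf)(n)=f(-xn)$. - For a weight module $M$ and $\lambda\in\mathfrak h^*$, $M^{\leqslant\lambda}$ is the quotient of $M$ by the submodule generated by all $M_\mu$ with $\mu\not\leqslant\lambda$. Let $N\in\widetilde{\mathcal O}$ and $\lambda\in\mathfrak h^*$. Then: 1. for every $M\in\mathcal F(\Delta)$, the module $(M\otimes N^*)^{\leqslant\lambda}$ lies in $\mathcal F(\Delta)$, and it is finitely generated and free over $U(\mathfrak n_-)$; 2. for every $M\in\mathcal O$, the module $(M\otimes N^*)^{\leqslant\lambda}$ lies in $\mathcal O$. -/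

import Mathlib

open scoped TensorProduct

noncomputable section

namespace CatO

open LieAlgebra LieModule

/-! ### Modules over universal enveloping algebras -/

section Enveloping

/-- A module over a complex Lie algebra `L`, regarded as a module over `U(L)`. -/
@[reducible] def envModule (L : Type*) [LieRing L] [LieAlgebra ℂ L]
    (M : Type*) [AddCommGroup M] [Module ℂ M] [LieRingModule L M] [LieModule ℂ L M] :
    Module (UniversalEnvelopingAlgebra ℂ L) M :=
  Module.compHom M (UniversalEnvelopingAlgebra.lift ℂ (LieModule.toEnd ℂ L M) :
    UniversalEnvelopingAlgebra ℂ L →ₐ[ℂ] Module.End ℂ M).toRingHom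

/-- `M` is finitely generated as a `U(L)`-module. -/
def EnvFinite (L : Type*) [LieRing L] [LieAlgebra ℂ L]
    (M : Type*) [AddCommGroup M] [Module ℂ M] [LieRingModule L M] [LieModule ℂ L M] : Prop :=
  letI := envModule L M
  Module.Finite (UniversalEnvelopingAlgebra ℂ L) M

/-- `M` is free as a `U(L)`-module. -/
def EnvFree (L : Type*) [LieRing L] [LieAlgebra ℂ L]
    (M : Type*) [AddCommGroup M] [Module ℂ M] [LieRingModule L M] [LieModule ℂ L M] : Prop :=
  letI := envModule L M
  Module.Free (UniversalEnvelopingAlgebra ℂ L) M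

end Enveloping

section Main

variable {𝔤 : Type*} [LieRing 𝔤] [LieAlgebra ℂ 𝔤] [FiniteDimensional ℂ 𝔤]
  [LieAlgebra.IsSemisimple ℂ 𝔤] {H : LieSubalgebra ℂ 𝔤} [H.IsCartanSubalgebra]

/-! ### Triangular decomposition and the order on weights

A Cartan subalgebra `H` and a base `b` of the root system give the triangular decomposition
`𝔤 = 𝔫₋ ⊕ H ⊕ 𝔫₊`, with `𝔫₊` (`𝔫₋`) the sum of the root spaces of positive (negative) roots. -/

/-- The subalgebra `𝔫₋`, the sum of the root spaces of the negatives of the positive roots. -/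
def nMinus (b : (IsKilling.rootSystem H).Base) : LieSubalgebra ℂ 𝔤 where
  __ := ⨆ i : {i : H.root // b.IsPos i},
    (rootSpace H (-(i.1.1 : H → ℂ))).toSubmodule
  lie_mem' := by
    intro x y hx hy
    change x ∈ ⨆ i : {i : H.root // b.IsPos i},
      (rootSpace H (-(i.1.1 : H → ℂ))).toSubmodule at hx
    change y ∈ ⨆ i : {i : H.root // b.IsPos i},
      (rootSpace H (-(i.1.1 : H → ℂ))).toSubmodule at hy
    change ⁅x, y⁆ ∈ ⨆ i : {i : H.root // b.IsPos i},
      (rootSpace H (-(i.1.1 : H → ℂ))).toSubmodule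
    induction hx using Submodule.iSup_induction' with
    | zero => simp
    | add x x' _ _ h h' => rw [add_lie]; exact add_mem h h'
    | mem i x hx =>
      induction hy using Submodule.iSup_induction' with
      | zero => simp
      | add y y' _ _ h h' => rw [lie_add]; exact add_mem h h'
      | mem j y hy =>
        have hxy : ⁅x, y⁆ ∈ rootSpace H (-(i.1.1 : H → ℂ) + -(j.1.1 : H → ℂ)) :=
          lie_mem_genWeightSpace_of_mem_genWeightSpace hx hy
        by_cases hbot : rootSpace H (-(i.1.1 : H → ℂ) + -(j.1.1 : H → ℂ)) = ⊥
        · rw [hbot, LieSubmodule.mem_bot] at hxy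
          rw [hxy]; exact zero_mem _
        · let γ : Weight ℂ H 𝔤 := ⟨_, hbot⟩
          let P := IsKilling.rootSystem H
          let _ := P.indexNeg
          have hneg : ∀ k : H.root, ((-k).1 : H → ℂ) = -(k.1 : H → ℂ) := by
            intro k
            have h : P.root (-k) = -P.root k := by simp
            funext t
            exact DFunLike.congr_fun h t
          have hγ : γ.IsNonZero := by
            intro h0
            have h1 : (j.1.1 : H → ℂ) = -(i.1.1 : H → ℂ) := by
              have h2 : -(i.1.1 : H → ℂ) + -(j.1.1 : H → ℂ) = 0 := h0
              rw [← sub_eq_add_neg, sub_eq_zero] at h2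
              exact h2.symm
            have h3 : j.1 = -i.1 := by
              apply Subtype.ext
              apply DFunLike.coe_injective
              rw [h1, hneg]
            have h4 := j.2
            rw [h3, RootPairing.Base.IsPos.neg_iff_not] at h4
            exact h4 i.2
          let k : H.root := ⟨γ, by simpa using hγ⟩
          have hk : b.IsPos (-k) := by
            refine RootPairing.Base.IsPos.add i.2 j.2 ?_
            ext h
            change ((-k).1 : H → ℂ) h = (i.1.1 : H → ℂ) h + (j.1.1 : H → ℂ) h
            rw [hneg]
            change -(-(i.1.1 : H → ℂ) h + -(j.1.1 : H → ℂ) h) = _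
            ring
          refine Submodule.mem_iSup_of_mem ⟨-k, hk⟩ ?_
          rw [hneg, neg_neg]
          exact hxy

/-- The natural partial order on `𝔥*`: `μ ≤ ν` iff `ν - μ` is a sum of positive roots
(equivalently, `μ - ν` is a sum of negative roots). -/
def WeightLE (b : (IsKilling.rootSystem H).Base) (μ ν : Module.Dual ℂ H) : Prop :=
  ν - μ ∈ AddSubmonoid.closure {β | ∃ i, b.IsPos i ∧ β = (IsKilling.rootSystem H).root i}

/-! ### Weight modules and the categories `𝒪` and `𝒪~`

Here `LieModule.weightSpace M μ` is the honest simultaneous eigenspace for `H`. -/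

section Categories

variable (H) in
/-- `M` is a weight module: it is the sum of its weight spaces
(such a sum is automatically direct). -/
def IsWeightModule (M : Type*) [AddCommGroup M] [Module ℂ M] [LieRingModule 𝔤 M]
    [LieModule ℂ 𝔤 M] : Prop :=
  ⨆ μ : Module.Dual ℂ H, (weightSpace M (μ : H → ℂ) : LieSubmodule ℂ H M) = ⊤

/-- The category `𝒪`: weight modules finitely generated over `U(𝔫₋)`. -/
structure InO (b : (IsKilling.rootSystem H).Base) (M : Type*) [AddCommGroup M] [Module ℂ M]
    [LieRingModule 𝔤 M] [LieModule ℂ 𝔤 M] : Prop where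
  isWeightModule : IsWeightModule H M
  finite : EnvFinite (nMinus b) M

/-- The enlarged category `𝒪~`: weight modules whose weights lie below finitely many given
weights, with finite-dimensional weight spaces. -/
structure InOTilde (b : (IsKilling.rootSystem H).Base) (M : Type*) [AddCommGroup M]
    [Module ℂ M] [LieRingModule 𝔤 M] [LieModule ℂ 𝔤 M] : Prop where
  isWeightModule : IsWeightModule H M
  support_le : ∃ S : Finset (Module.Dual ℂ H), ∀ μ : Module.Dual ℂ H,
    (weightSpace M (μ : H → ℂ) : LieSubmodule ℂ H M) ≠ ⊥ → ∃ ν ∈ S, WeightLE b μ ν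
  finiteDimensional : ∀ μ : Module.Dual ℂ H,
    FiniteDimensional ℂ (weightSpace M (μ : H → ℂ) : LieSubmodule ℂ H M)

end Categories

/-! ### Verma modules and Verma filtrations -/

/-- The left ideal of `U(𝔤)` generated by `𝔫₊` and all `h - wt h` with `h ∈ H`. -/
def vermaIdeal (b : (IsKilling.rootSystem H).Base) (wt : Module.Dual ℂ H) :
    Submodule (UniversalEnvelopingAlgebra ℂ 𝔤) (UniversalEnvelopingAlgebra ℂ 𝔤) :=
  Submodule.span _
    ({u | ∃ i, b.IsPos i ∧ ∃ x ∈ rootSpace H (i.1 : H → ℂ),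
        u = UniversalEnvelopingAlgebra.ι ℂ x} ∪
     {u | ∃ h : H, u = UniversalEnvelopingAlgebra.ι ℂ (h : 𝔤) -
        algebraMap ℂ (UniversalEnvelopingAlgebra ℂ 𝔤) (wt h)})

/-- The Verma module `Δ(wt)` of highest weight `wt`. -/
def Verma (b : (IsKilling.rootSystem H).Base) (wt : Module.Dual ℂ H) : Type _ :=
  UniversalEnvelopingAlgebra ℂ 𝔤 ⧸ vermaIdeal b wt

namespace Verma

variable (b : (IsKilling.rootSystem H).Base) (wt : Module.Dual ℂ H)

instance : AddCommGroup (Verma b wt) :=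
  inferInstanceAs (AddCommGroup (UniversalEnvelopingAlgebra ℂ 𝔤 ⧸ vermaIdeal b wt))

instance : Module (UniversalEnvelopingAlgebra ℂ 𝔤) (Verma b wt) :=
  inferInstanceAs (Module (UniversalEnvelopingAlgebra ℂ 𝔤)
    (UniversalEnvelopingAlgebra ℂ 𝔤 ⧸ vermaIdeal b wt))

instance : Module ℂ (Verma b wt) :=
  inferInstanceAs (Module ℂ (UniversalEnvelopingAlgebra ℂ 𝔤 ⧸ vermaIdeal b wt))

instance : IsScalarTower ℂ (UniversalEnvelopingAlgebra ℂ 𝔤) (Verma b wt) :=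
  inferInstanceAs (IsScalarTower ℂ (UniversalEnvelopingAlgebra ℂ 𝔤)
    (UniversalEnvelopingAlgebra ℂ 𝔤 ⧸ vermaIdeal b wt))

instance : SMulCommClass ℂ (UniversalEnvelopingAlgebra ℂ 𝔤) (Verma b wt) :=
  IsScalarTower.to_smulCommClass

instance : LieRingModule 𝔤 (Verma b wt) where
  bracket x m := UniversalEnvelopingAlgebra.ι ℂ x • m
  add_lie x y m := by
    rw [map_add, add_smul]
  lie_add x m n := smul_add _ _ _
  leibniz_lie x y m := by
    let _ := LieRing.ofAssociativeRing (A := UniversalEnvelopingAlgebra ℂ 𝔤)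
    change UniversalEnvelopingAlgebra.ι ℂ x • UniversalEnvelopingAlgebra.ι ℂ y • m =
      UniversalEnvelopingAlgebra.ι ℂ ⁅x, y⁆ • m +
        UniversalEnvelopingAlgebra.ι ℂ y • UniversalEnvelopingAlgebra.ι ℂ x • m
    rw [LieHom.map_lie, LieRing.of_associative_ring_bracket, sub_smul, mul_smul, mul_smul]
    abel

instance : LieModule ℂ 𝔤 (Verma b wt) where
  smul_lie t x m := by
    change UniversalEnvelopingAlgebra.ι ℂ (t • x) • m =
      t • UniversalEnvelopingAlgebra.ι ℂ x • m
    rw [map_smul, smul_assoc]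
  lie_smul t x m := smul_comm _ _ _

end Verma

/-- `M` has a Verma filtration: a finite chain of submodules
`0 = F 0 ≤ F 1 ≤ ⋯ ≤ F k = M` with `F (i + 1) / F i` isomorphic to a Verma module. -/
def HasVermaFiltration (b : (IsKilling.rootSystem H).Base) (M : Type*) [AddCommGroup M]
    [Module ℂ M] [LieRingModule 𝔤 M] [LieModule ℂ 𝔤 M] : Prop :=
  ∃ (k : ℕ) (F : Fin (k + 1) → LieSubmodule ℂ 𝔤 M),
    F 0 = ⊥ ∧ F (Fin.last k) = ⊤ ∧
    ∀ i : Fin k, F i.castSucc ≤ F i.succ ∧ ∃ wt : Module.Dual ℂ H,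
      Nonempty ((F i.succ ⧸ (F i.castSucc).comap (F i.succ).incl) ≃ₗ⁅ℂ, 𝔤⁆ Verma b wt)

/-- The category `ℱ(Δ)`: modules in `𝒪` that have a Verma filtration. -/
structure InFDelta (b : (IsKilling.rootSystem H).Base) (M : Type*) [AddCommGroup M]
    [Module ℂ M] [LieRingModule 𝔤 M] [LieModule ℂ 𝔤 M] : Prop where
  inO : InO b M
  hasVermaFiltration : HasVermaFiltration b M

/-! ### The restricted dual and the truncation -/

section Constructions

variable (H) in
/-- The restricted dual `M^* = ⨁_μ Hom(M_μ, ℂ)` of a weight module `M`, with `𝔤`-action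
`(x f)(m) = f (-x m)`. As `M` is the direct sum of its weight spaces, this is the submodule of
the full dual consisting of the functionals that vanish on all but finitely many weight spaces. -/
def restrictedDual (M : Type*) [AddCommGroup M] [Module ℂ M] [LieRingModule 𝔤 M]
    [LieModule ℂ 𝔤 M] : LieSubmodule ℂ 𝔤 (Module.Dual ℂ M) where
  carrier := {f | {μ : Module.Dual ℂ H |
    ∃ m ∈ (weightSpace M (μ : H → ℂ) : LieSubmodule ℂ H M), f m ≠ 0}.Finite}
  zero_mem' := by simp
  add_mem' := by
    intro f f' hf hf'
    refine (hf.union hf').subset ?_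
    rintro μ ⟨m, hm, hne⟩
    by_cases h : f m = 0
    · exact Or.inr ⟨m, hm, fun h' => hne (by simp [h, h'])⟩
    · exact Or.inl ⟨m, hm, h⟩
  smul_mem' := by
    intro c f hf
    refine hf.subset ?_
    rintro μ ⟨m, hm, hne⟩
    exact ⟨m, hm, fun h => hne (by simp [h])⟩
  lie_mem := by
    intro x f hf
    change Set.Finite {μ : Module.Dual ℂ H |
      ∃ m ∈ (weightSpace M (μ : H → ℂ) : LieSubmodule ℂ H M), f m ≠ 0} at hf
    change Set.Finite {μ : Module.Dual ℂ H |
      ∃ m ∈ (weightSpace M (μ : H → ℂ) : LieSubmodule ℂ H M), ⁅x, f⁆ m ≠ 0}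
    have hx : x ∈ ⨆ α : Weight ℂ H 𝔤, (rootSpace H (α : H → ℂ)).toSubmodule := by
      rw [← LieSubmodule.iSup_toSubmodule, LieModule.iSup_genWeightSpace_eq_top' ℂ H 𝔤]
      trivial
    induction hx using Submodule.iSup_induction' with
    | zero => simp
    | add x y _ _ h h' =>
      refine (h.union h').subset ?_
      rintro μ ⟨m, hm, hne⟩
      by_cases h : ⁅x, f⁆ m = 0
      · exact Or.inr ⟨m, hm, fun h' => hne (by rw [add_lie, LinearMap.add_apply, h, h', add_zero])⟩
      · exact Or.inl ⟨m, hm, h⟩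
    | mem α x hx =>
      refine (hf.preimage (f := fun μ => α.toLinear + μ)
        (add_right_injective _).injOn).subset ?_
      rintro μ ⟨m, hm, hne⟩
      refine ⟨⁅x, m⁆, ?_, fun h => hne (by simp [h])⟩
      rw [mem_weightSpace] at hm ⊢
      intro h
      have h1 : ⁅(h : 𝔤), x⁆ = α h • x :=
        LieAlgebra.IsKilling.lie_eq_smul_of_mem_rootSpace hx h
      have h2 : ⁅(h : 𝔤), m⁆ = μ h • m := hm h
      change ⁅(h : 𝔤), ⁅x, m⁆⁆ = (α h + μ h) • ⁅x, m⁆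
      rw [leibniz_lie, h1, h2, smul_lie, lie_smul, add_smul]

/-- The submodule of `M` generated by the weight spaces `M_μ` with `μ ≰ wt`. -/
def truncSubmodule (b : (IsKilling.rootSystem H).Base) (wt : Module.Dual ℂ H)
    (M : Type*) [AddCommGroup M] [Module ℂ M] [LieRingModule 𝔤 M] [LieModule ℂ 𝔤 M] :
    LieSubmodule ℂ 𝔤 M :=
  LieSubmodule.lieSpan ℂ 𝔤
    {m | ∃ μ : Module.Dual ℂ H, ¬ WeightLE b μ wt ∧
      m ∈ (weightSpace M (μ : H → ℂ) : LieSubmodule ℂ H M)}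

/-- The truncation `M^{≤ wt}`: the quotient of `M` by the submodule generated by the weight
spaces `M_μ` with `μ ≰ wt`. -/
abbrev Trunc (b : (IsKilling.rootSystem H).Base) (wt : Module.Dual ℂ H)
    (M : Type*) [AddCommGroup M] [Module ℂ M] [LieRingModule 𝔤 M] [LieModule ℂ 𝔤 M] : Type _ :=
  M ⧸ truncSubmodule b wt M

end Constructions

end Main

end CatO

end

open scoped TensorProduct

set_option linter.unusedSectionVars false

noncomputable section

namespace CatO

open LieAlgebra LieModule

/-! ### Modules over a complex Lie algebra as modules over its enveloping algebra. -/

section Enveloping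

variable {L : Type*} [LieRing L] [LieAlgebra ℂ L]

attribute [local instance] envModule

local notation "𝒰" => UniversalEnvelopingAlgebra ℂ
local notation "ιᵤ" => UniversalEnvelopingAlgebra.ι ℂ

/-! Everything is read off from generators over `U(𝔫₋)` that are weight vectors. A module `M` in `𝒪`
has finitely many such generators `v i`. If `M` has a Verma filtration, they can be chosen to form a
`U(𝔫₋)`-basis, because Verma modules are free of rank one over `U(𝔫₋)` and weight vectors lift along
quotients of weight modules (`HasVermaFiltration.exists_basis`). The restricted dual of `N` has a
basis of weight vectors `c j`. Their weights are the negatives of weights of `N`, so they lie above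
finitely many given weights. As intervals in the weight order are finite, only finitely many `c j`
have a weight below a given one (`InOTilde.exists_dual_basis`).

The vectors `v i ⊗ c j` generate `M ⊗ N^*` over `U(𝔫₋)`, and they form a basis if the `v i` do
(`span_tmul_eq_top`, `linearIndependent_tmul`). Since `𝔫₋` lowers weights, a weight vector whose
weight lies in an upper set is a combination of the generators with weights in that set
(`mem_span_of_mem_wtSpace`). For the upper set of weights `≰ wt` this shows that the submodule
killed by the truncation is the `U(𝔫₋)`-span of the generators with these weights
(`mem_truncSubmodule_iff`). Hence the truncation is generated by the remaining ones, freely in the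
basis case, and there are finitely many of them.

Finally, a finite `U(𝔫₋)`-basis of weight vectors, sorted by decreasing height, yields a Verma
filtration: positive root vectors send each basis vector into the span of the earlier ones, so each
subquotient is free of rank one on a highest weight vector (`hasVermaFiltration_of_basis`). The
freeness of Verma modules is obtained by constructing the `𝔤`-action on `U(𝔫₋)` directly
(`exists_induced_action`), without the Poincaré–Birkhoff–Witt theorem. -/

theorem adjoin_range_ι :
    Algebra.adjoin ℂ (Set.range (ιᵤ : L → 𝒰 L)) = ⊤ := by
  let _ := LieRing.ofAssociativeRing (A := 𝒰 L)
  set S := Algebra.adjoin ℂ (Set.range (ιᵤ : L → 𝒰 L)) with hS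
  let _ := LieRing.ofAssociativeRing (A := S)
  -- The lift of this corestriction of `ι`, followed by the inclusion of `S`, is the identity by the
  -- universal property, so every element lies in `S`.
  let f : L →ₗ⁅ℂ⁆ S :=
    { toFun := fun x => ⟨ιᵤ x, Algebra.subset_adjoin ⟨x, rfl⟩⟩
      map_add' := fun x y => Subtype.ext (map_add _ x y)
      map_smul' := fun c x => Subtype.ext (map_smul _ c x)
      map_lie' := fun {x y} => Subtype.ext (LieHom.map_lie _ x y) }
  have h : S.val.comp (UniversalEnvelopingAlgebra.lift ℂ f) = AlgHom.id ℂ (𝒰 L) := by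
    ext x
    change (UniversalEnvelopingAlgebra.lift ℂ f (ιᵤ x) : 𝒰 L) = ιᵤ x
    rw [UniversalEnvelopingAlgebra.lift_ι_apply]
    rfl
  refine eq_top_iff.2 fun u _ => ?_
  have := DFunLike.congr_fun h u
  rw [AlgHom.id_apply] at this
  rw [← this]
  exact (UniversalEnvelopingAlgebra.lift ℂ f u).2

/-- A subspace of a `U(L)`-module that is stable under `L` is stable under `U(L)`. -/
theorem smul_mem_of_ι_smul_mem {M : Type*} [AddCommGroup M] [Module ℂ M] [Module (𝒰 L) M]
    [IsScalarTower ℂ (𝒰 L) M] {p : Submodule ℂ M} (hp : ∀ (x : L), ∀ m ∈ p, ιᵤ x • m ∈ p)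
    (u : 𝒰 L) {m : M} (hm : m ∈ p) : u • m ∈ p := by
  have hu : u ∈ Algebra.adjoin ℂ (Set.range (ιᵤ : L → 𝒰 L)) := by
    rw [adjoin_range_ι]; trivial
  induction hu using Algebra.adjoin_induction generalizing m with
  | mem a ha => obtain ⟨x, rfl⟩ := ha; exact hp x m hm
  | algebraMap r => rw [algebraMap_smul]; exact p.smul_mem r hm
  | add a c _ _ ha hc => rw [add_smul]; exact p.add_mem (ha hm) (hc hm)
  | mul a c _ _ ha hc => rw [mul_smul]; exact ha (hc hm)

/-- Induction on `U(L)` from the left. -/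
theorem env_induction {P : 𝒰 L → Prop} (one : P 1) (add : ∀ u v, P u → P v → P (u + v))
    (smul : ∀ (c : ℂ) u, P u → P (c • u)) (mul : ∀ x u, P u → P (ιᵤ x * u)) (u : 𝒰 L) : P u := by
  let p : Submodule ℂ (𝒰 L) :=
    { carrier := {u | P u}
      add_mem' := fun {a c} => add a c
      zero_mem' := by simpa using smul 0 1 one
      smul_mem' := fun c {a} => smul c a }
  have h : u • (1 : 𝒰 L) ∈ p := smul_mem_of_ι_smul_mem (p := p) (fun x m hm => mul x m hm) u one
  rwa [smul_eq_mul, mul_one] at h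

/-- A linear map that commutes with `L` is `U(L)`-linear. -/
def envLinear {M M' : Type*} [AddCommGroup M] [Module ℂ M] [Module (𝒰 L) M]
    [IsScalarTower ℂ (𝒰 L) M] [AddCommGroup M'] [Module ℂ M'] [Module (𝒰 L) M']
    [IsScalarTower ℂ (𝒰 L) M'] (f : M →ₗ[ℂ] M')
    (hf : ∀ (x : L) m, f (ιᵤ x • m) = ιᵤ x • f m) : M →ₗ[𝒰 L] M' where
  toFun := f
  map_add' := map_add f
  map_smul' u m := by
    rw [RingHom.id_apply]
    induction u using env_induction generalizing m with
    | one => simp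
    | add u v hu hv => simp only [add_smul, map_add, hu, hv]
    | smul c u hu => simp only [smul_assoc, map_smul, hu]
    | mul x u hu => simp only [mul_smul, hf, hu]

@[simp] theorem envLinear_apply {M M' : Type*} [AddCommGroup M] [Module ℂ M] [Module (𝒰 L) M]
    [IsScalarTower ℂ (𝒰 L) M] [AddCommGroup M'] [Module ℂ M'] [Module (𝒰 L) M']
    [IsScalarTower ℂ (𝒰 L) M'] (f : M →ₗ[ℂ] M')
    (hf : ∀ (x : L) m, f (ιᵤ x • m) = ιᵤ x • f m) (m : M) : envLinear f hf m = f m := rfl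

section LieModules

variable {M : Type*} [AddCommGroup M] [Module ℂ M] [LieRingModule L M] [LieModule ℂ L M]

theorem env_smul_def (u : 𝒰 L) (m : M) :
    u • m = UniversalEnvelopingAlgebra.lift ℂ (LieModule.toEnd ℂ L M) u m := rfl

theorem ι_smul (x : L) (m : M) : ιᵤ x • m = ⁅x, m⁆ := by
  rw [env_smul_def, UniversalEnvelopingAlgebra.lift_ι_apply, LieModule.toEnd_apply_apply]

theorem envModule_isScalarTower : IsScalarTower ℂ (𝒰 L) M where
  smul_assoc c u m := by
    rw [env_smul_def, map_smul, LinearMap.smul_apply, ← env_smul_def]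

attribute [local instance] envModule_isScalarTower

/-- A subspace stable under `L`, as a `U(L)`-submodule. -/
def envSubmodule (p : Submodule ℂ M) (hp : ∀ (x : L), ∀ m ∈ p, ⁅x, m⁆ ∈ p) :
    Submodule (𝒰 L) M where
  toAddSubmonoid := p.toAddSubmonoid
  smul_mem' u _ hm := smul_mem_of_ι_smul_mem (p := p)
    (fun x m hm => by rw [ι_smul]; exact hp x m hm) u hm

theorem lie_mem_of_mem (P : Submodule (𝒰 L) M) (x : L) {m : M} (hm : m ∈ P) : ⁅x, m⁆ ∈ P := by
  rw [← ι_smul]; exact P.smul_mem _ hm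

theorem smul_mem_of_mem (P : Submodule (𝒰 L) M) (c : ℂ) {m : M} (hm : m ∈ P) : c • m ∈ P :=
  (P.restrictScalars ℂ).smul_mem c hm

/-! ### Tensor products -/

variable {X : Type*} [AddCommGroup X] [Module ℂ X] [LieRingModule L X] [LieModule ℂ L X]

/-- Generators of a `U(L)`-module, tensored with a spanning set of a second module. -/
theorem span_tmul_eq_top {I J : Type*} {v : I → M} {c : J → X}
    (hv : Submodule.span (𝒰 L) (Set.range v) = ⊤) (hc : Submodule.span ℂ (Set.range c) = ⊤) :
    Submodule.span (𝒰 L) (Set.range fun p : I × J => v p.1 ⊗ₜ[ℂ] c p.2) = ⊤ := by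
  set P := Submodule.span (𝒰 L) (Set.range fun p : I × J => v p.1 ⊗ₜ[ℂ] c p.2) with hP
  -- Stability of `q` under `L` is the identity `ym ⊗ x = y(m ⊗ x) - m ⊗ yx`. This is why `q`
  -- quantifies over all `x`.
  let q : Submodule ℂ M :=
    { carrier := {m | ∀ x : X, m ⊗ₜ[ℂ] x ∈ P}
      add_mem' := fun {a a'} ha ha' x => by
        rw [TensorProduct.add_tmul]; exact P.add_mem (ha x) (ha' x)
      zero_mem' := fun x => by rw [TensorProduct.zero_tmul]; exact P.zero_mem
      smul_mem' := fun r a ha x => by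
        rw [← TensorProduct.smul_tmul']; exact smul_mem_of_mem P r (ha x) }
  have hq : ∀ (y : L), ∀ m ∈ q, ⁅y, m⁆ ∈ q := fun y m hm x => by
    have h := TensorProduct.LieModule.lie_tmul_right (R := ℂ) y m x
    rw [← sub_eq_iff_eq_add] at h
    rw [← h]
    exact P.sub_mem (lie_mem_of_mem P y (hm x)) (hm ⁅y, x⁆)
  have hvq : ∀ i, v i ∈ q := fun i x => by
    have hx : x ∈ Submodule.span ℂ (Set.range c) := by rw [hc]; trivial
    have hle : Submodule.span ℂ (Set.range c) ≤
        (P.restrictScalars ℂ).comap (TensorProduct.mk ℂ M X (v i)) := by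
      rw [Submodule.span_le]
      rintro _ ⟨j, rfl⟩
      exact Submodule.subset_span ⟨(i, j), rfl⟩
    exact hle hx
  have hqt : envSubmodule q hq = ⊤ := by
    rw [eq_top_iff, ← hv, Submodule.span_le]
    rintro _ ⟨i, rfl⟩
    exact hvq i
  refine eq_top_iff.2 fun t _ => ?_
  induction t using TensorProduct.induction_on with
  | zero => exact P.zero_mem
  | tmul m x =>
    have : m ∈ envSubmodule q hq := by rw [hqt]; trivial
    exact this x
  | add s t hs ht => exact P.add_mem (hs trivial) (ht trivial)

/-- `U(L)` as a left module over `L`. -/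
@[reducible] def envLieRingModule (L : Type*) [LieRing L] [LieAlgebra ℂ L] :
    LieRingModule L (𝒰 L) where
  bracket x u := ιᵤ x * u
  add_lie x y m := by rw [map_add, add_mul]
  lie_add x m n := mul_add _ _ _
  leibniz_lie x y m := by
    let _ := LieRing.ofAssociativeRing (A := 𝒰 L)
    change ιᵤ x * (ιᵤ y * m) = ιᵤ ⁅x, y⁆ * m + ιᵤ y * (ιᵤ x * m)
    rw [LieHom.map_lie, LieRing.of_associative_ring_bracket, sub_mul, mul_assoc, mul_assoc]
    abel

attribute [local instance] envLieRingModule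

theorem envLieModule (L : Type*) [LieRing L] [LieAlgebra ℂ L] : LieModule ℂ L (𝒰 L) where
  smul_lie t x m := by
    change ιᵤ (t • x) * m = t • (ιᵤ x * m)
    rw [map_smul, smul_mul_assoc]
  lie_smul t x m := mul_smul_comm _ _ _

attribute [local instance] envLieModule

/-- The map `U(L) → Hom(X, U(L))` of `L`-modules that sends `1` to `φ`. -/
def envToHom (φ : X →ₗ[ℂ] 𝒰 L) : 𝒰 L →ₗ[ℂ] X →ₗ[ℂ] 𝒰 L :=
  (LinearMap.applyₗ φ).comp
    (UniversalEnvelopingAlgebra.lift ℂ (LieModule.toEnd ℂ L (X →ₗ[ℂ] 𝒰 L))).toLinearMap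

@[simp] theorem envToHom_one (φ : X →ₗ[ℂ] 𝒰 L) : envToHom φ 1 = φ := by
  simp [envToHom]

/-- This is the action on a Hom space, `(yψ)(x) = yψ(x) - ψ(yx)`. It serves twice: it makes
functionals on tensor products equivariant, and it is the recursion that defines the induced action
on `U(n)`. -/
theorem envToHom_ι_mul (φ : X →ₗ[ℂ] 𝒰 L) (y : L) (u : 𝒰 L) (x : X) :
    envToHom φ (ιᵤ y * u) x = ιᵤ y * envToHom φ u x - envToHom φ u ⁅y, x⁆ := by
  change (UniversalEnvelopingAlgebra.lift ℂ (LieModule.toEnd ℂ L (X →ₗ[ℂ] 𝒰 L)) (ιᵤ y * u)) φ x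
    = _
  rw [map_mul, UniversalEnvelopingAlgebra.lift_ι_apply, Module.End.mul_apply,
    LieModule.toEnd_apply_apply, LieHom.lie_apply]
  rfl

/-- A `U(L)`-basis, tensored with linearly independent vectors of a second module. -/
theorem linearIndependent_tmul {I J : Type*} {v : I → M} {c : J → X}
    (hv : LinearIndependent (𝒰 L) v) (hvs : Submodule.span (𝒰 L) (Set.range v) = ⊤)
    (hc : LinearIndependent ℂ c) :
    LinearIndependent (𝒰 L) (fun p : I × J => v p.1 ⊗ₜ[ℂ] c p.2) := by
  classical
  let B := Module.Basis.mk hv hvs.ge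
  -- Independence follows from a dual family of `U(L)`-linear functionals.
  have key : ∀ i₀ j₀, ∃ F : M ⊗[ℂ] X →ₗ[𝒰 L] 𝒰 L, ∀ i j,
      F (v i ⊗ₜ c j) = if (i, j) = (i₀, j₀) then 1 else 0 := by
    intro i₀ j₀
    obtain ⟨f, hf⟩ : ∃ f : X →ₗ[ℂ] ℂ, ∀ j, f (c j) = if j = j₀ then 1 else 0 := by
      obtain ⟨f, hf⟩ := ((Module.Basis.span hc).constr ℂ
        (fun j => if j = j₀ then (1 : ℂ) else 0)).exists_extend
      refine ⟨f, fun j => ?_⟩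
      have h1 := DFunLike.congr_fun hf (Module.Basis.span hc j)
      rw [Module.Basis.constr_basis] at h1
      rw [← h1, LinearMap.comp_apply, Submodule.subtype_apply, Module.Basis.span_apply]
    let coord : M →ₗ[ℂ] 𝒰 L := (B.coord i₀).restrictScalars ℂ
    have hcoord : ∀ (y : L) m, coord ⁅y, m⁆ = ιᵤ y * coord m := fun y m => by
      rw [← ι_smul]; exact (B.coord i₀).map_smul _ _
    -- An `L`-equivariant map `M → Hom(X, U(L))` that sends `v i₀` to `x ↦ f x • 1` and the other `v
    -- i` to zero; its adjoint on `M ⊗ X` is the functional wanted.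
    let Φ : M →ₗ[ℂ] X →ₗ[ℂ] 𝒰 L := (envToHom (f.smulRight (1 : 𝒰 L))).comp coord
    refine ⟨envLinear (TensorProduct.lift Φ) ?_, fun i j => ?_⟩
    · intro y t
      rw [ι_smul]
      induction t using TensorProduct.induction_on with
      | zero => rw [lie_zero, map_zero, smul_zero]
      | add s t hs ht => rw [lie_add, map_add, map_add, hs, ht, smul_add]
      | tmul m x =>
        rw [TensorProduct.LieModule.lie_tmul_right, map_add, TensorProduct.lift.tmul,
          TensorProduct.lift.tmul, TensorProduct.lift.tmul]
        simp only [Φ, LinearMap.comp_apply, hcoord, envToHom_ι_mul, sub_add_cancel, smul_eq_mul]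
    · have h : coord (v i) = if i = i₀ then 1 else 0 := by
        have : v i = B i := by simp [B]
        change B.coord i₀ (v i) = _
        rw [this, Module.Basis.coord_apply, Module.Basis.repr_self, Finsupp.single_apply]
      rw [envLinear_apply, TensorProduct.lift.tmul, LinearMap.comp_apply, h]
      by_cases hi : i = i₀ <;> by_cases hj : j = j₀ <;> simp [hi, hj, hf]
  rw [linearIndependent_iff]
  intro l hl
  ext ⟨i₀, j₀⟩
  obtain ⟨F, hF⟩ := key i₀ j₀
  have h := congrArg F hl
  rw [Finsupp.linearCombination_apply, map_finsuppSum, map_zero] at h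
  simp only [map_smul, hF] at h
  simpa [Finsupp.sum_ite_eq] using h

end LieModules

end Enveloping

/-! ### The action induced from a character of a complement. -/

section InducedAction

attribute [local instance] envModule

local notation "𝒰" => UniversalEnvelopingAlgebra ℂ
local notation "ιᵤ" => UniversalEnvelopingAlgebra.ι ℂ

/-- Let `n` be a subalgebra with a complement `q` and let `φ` extend `ι : n → U(n)` by a character
of `q`. Then `U(n)` is a module over the whole Lie algebra, with `n` acting by left multiplication
and `q` acting on `1` by the character. -/
theorem exists_induced_action {𝔤 : Type*} [LieRing 𝔤] [LieAlgebra ℂ 𝔤] (n : LieSubalgebra ℂ 𝔤)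
    (q : Submodule ℂ 𝔤) (hq : ∀ z : 𝔤, ∃ y : n, ∃ x ∈ q, z = y + x) (φ : 𝔤 →ₗ[ℂ] 𝒰 n)
    (hφ : ∀ y : n, φ y = ιᵤ y) (hχ : ∀ x ∈ q, φ x ∈ Submodule.span ℂ {(1 : 𝒰 n)})
    (hqq : ∀ x ∈ q, ∀ x' ∈ q, φ ⁅x, x'⁆ = 0) :
    ∃ ρ : 𝒰 𝔤 →ₐ[ℂ] Module.End ℂ (𝒰 n), (∀ (y : n) u, ρ (ιᵤ (y : 𝔤)) u = ιᵤ y * u) ∧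
      ∀ x, ρ (ιᵤ x) 1 = φ x := by
  -- Any action with `z · 1 = φ z` must satisfy `z(yu) = y(zu) - [y,z]u` for `y` in `n`. This
  -- recursion on `u` is the rule for the map to `Hom(𝔤, U(n))` that sends `1` to `φ`.
  let ρ : 𝔤 →ₗ[ℂ] Module.End ℂ (𝒰 n) := (envToHom φ).flip
  have h1 (z : 𝔤) : ρ z 1 = φ z := by
    change envToHom φ 1 z = φ z
    rw [envToHom_one]
  have hmul (z : 𝔤) (y : n) (u : 𝒰 n) : ρ z (ιᵤ y * u) = ιᵤ y * ρ z u - ρ ⁅(y : 𝔤), z⁆ u :=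
    envToHom_ι_mul φ y u z
  have hy (y : n) (u : 𝒰 n) : ρ y u = ιᵤ y * u := by
    induction u using env_induction generalizing y with
    | one => rw [h1, hφ, mul_one]
    | add u v hu hv => rw [map_add, hu, hv, mul_add]
    | smul c u hu => rw [map_smul, hu, mul_smul_comm]
    | mul x u hu =>
      let _ := LieRing.ofAssociativeRing (A := 𝒰 n)
      have := hu ⁅x, y⁆
      rw [LieSubalgebra.coe_bracket, LieHom.map_lie, LieRing.of_associative_ring_bracket] at this
      rw [hmul, hu, this, sub_mul, mul_assoc, mul_assoc]
      abel
  -- The inductive step is the Jacobi identity, so the hypotheses on `q` matter only at `u = 1`.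
  -- There two elements of `q` act by scalars, hence commute, and `φ` kills their bracket.
  have hD (u : 𝒰 n) : ∀ z z' : 𝔤, ρ ⁅z, z'⁆ u = ρ z (ρ z' u) - ρ z' (ρ z u) := by
    induction u using env_induction with
    | one =>
      have hn (y : n) (z : 𝔤) : ρ ⁅(y : 𝔤), z⁆ 1 = ρ y (ρ z 1) - ρ z (ρ y 1) := by
        rw [hy, hy, hmul]
        abel
      intro z z'
      obtain ⟨y, x, hx, rfl⟩ := hq z
      obtain ⟨y', x', hx', rfl⟩ := hq z'
      have e1 := hn y x'
      have e2 := hn y' x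
      have e3 := hn y y'
      have e4 : ρ ⁅x, x'⁆ 1 = ρ x (ρ x' 1) - ρ x' (ρ x 1) := by
        obtain ⟨c, hc⟩ := Submodule.mem_span_singleton.1 (hχ x hx)
        obtain ⟨c', hc'⟩ := Submodule.mem_span_singleton.1 (hχ x' hx')
        rw [h1, hqq x hx x' hx', h1, h1, ← hc, ← hc', map_smul, map_smul, h1, h1, ← hc, ← hc',
          smul_comm, sub_self]
      rw [← lie_skew, map_neg, LinearMap.neg_apply] at e2
      rw [neg_eq_iff_eq_neg] at e2
      simp only [add_lie, lie_add, map_add, LinearMap.add_apply, e1, e2, e3, e4]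
      abel
    | add u v hu hv => intro z z'; simp only [map_add, hu, hv]; abel
    | smul c u hu => intro z z'; simp only [map_smul, hu, smul_sub]
    | mul y u hu =>
      intro z z'
      have e : ⁅(y : 𝔤), ⁅z, z'⁆⁆ = ⁅⁅(y : 𝔤), z⁆, z'⁆ + ⁅z, ⁅(y : 𝔤), z'⁆⁆ := leibniz_lie _ _ _
      simp only [hmul, map_sub, e, map_add, LinearMap.add_apply, hu, mul_sub]
      abel
  let _ := LieRing.ofAssociativeRing (A := Module.End ℂ (𝒰 n))
  let ρ' : 𝔤 →ₗ⁅ℂ⁆ Module.End ℂ (𝒰 n) :=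
    { ρ with
      map_lie' := fun {z z'} => LinearMap.ext fun u => by
        change ρ ⁅z, z'⁆ u = _
        rw [hD, LieRing.of_associative_ring_bracket]
        rfl }
  refine ⟨UniversalEnvelopingAlgebra.lift ℂ ρ', fun y u => ?_, fun x => ?_⟩
  · rw [UniversalEnvelopingAlgebra.lift_ι_apply]
    exact hy y u
  · rw [UniversalEnvelopingAlgebra.lift_ι_apply]
    change ρ x 1 = _
    rw [h1]

end InducedAction

/-! ### Independent families of submodules. -/

theorem exists_linearMap_of_iSupIndep {ι V W : Type*} [AddCommGroup V] [Module ℂ V]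
    [AddCommGroup W] [Module ℂ W] {p : ι → Submodule ℂ V} (hp : iSupIndep p) (ht : ⨆ i, p i = ⊤)
    (f : ∀ i, p i →ₗ[ℂ] W) : ∃ F : V →ₗ[ℂ] W, ∀ i (x : p i), F x = f i x := by
  classical
  have h := DirectSum.isInternal_submodule_of_iSupIndep_of_iSup_eq_top hp ht
  let e := LinearEquiv.ofBijective (DirectSum.coeLinearMap p) h
  refine ⟨(DirectSum.toModule ℂ ι W f).comp e.symm.toLinearMap, fun i x => ?_⟩
  have : e.symm (x : V) = DirectSum.lof ℂ ι (fun i => p i) i x := by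
    rw [LinearEquiv.symm_apply_eq]
    exact (DirectSum.coeLinearMap_lof p i x).symm
  rw [LinearMap.comp_apply, LinearEquiv.coe_coe, this, DirectSum.toModule_lof]

/-- If submodules of independent submodules span everything, then they are not smaller. -/
theorem eq_of_le_of_iSup_eq_top {R ι V : Type*} [Ring R] [AddCommGroup V] [Module R V]
    {p g : ι → Submodule R V} (hp : iSupIndep p) (hg : ∀ i, g i ≤ p i) (ht : ⨆ i, g i = ⊤) (i : ι) :
    g i = p i := by
  refine le_antisymm (hg i) ?_
  have h1 : g i ⊔ ⨆ (j) (_ : j ≠ i), p j = ⊤ := by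
    rw [eq_top_iff, ← ht]
    refine iSup_le fun j => ?_
    by_cases hj : j = i
    · subst hj; exact le_sup_left
    · exact le_sup_of_le_right ((hg j).trans (le_iSup₂_of_le j hj le_rfl))
  -- Modular law: `p i` is the supremum of `g i` and the intersection of `p i` with the other `p j`,
  -- which is zero by independence.
  have h2 := sup_inf_assoc_of_le (⨆ (j) (_ : j ≠ i), p j) (hg i)
  rw [h1, top_inf_eq, inf_comm, (hp i).eq_bot, sup_bot_eq] at h2
  exact h2.le

section Weights

variable {𝔤 : Type*} [LieRing 𝔤] [LieAlgebra ℂ 𝔤] [FiniteDimensional ℂ 𝔤]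
  [LieAlgebra.IsSemisimple ℂ 𝔤] {H : LieSubalgebra ℂ 𝔤} [H.IsCartanSubalgebra]

/-! ### The weight order -/

section Order

variable {b : (IsKilling.rootSystem H).Base}

theorem weightLE_refl (μ : Module.Dual ℂ H) : WeightLE b μ μ := by
  rw [WeightLE, sub_self]; exact zero_mem _

theorem WeightLE.trans {μ ν ξ : Module.Dual ℂ H} (h : WeightLE b μ ν) (h' : WeightLE b ν ξ) :
    WeightLE b μ ξ := by
  have := add_mem h' h
  rwa [sub_add_sub_cancel] at this

theorem weightLE_add_root {i : H.root} (hi : b.IsPos i) (μ : Module.Dual ℂ H) :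
    WeightLE b μ (i.1.toLinear + μ) := by
  rw [WeightLE, add_sub_cancel_right]
  exact AddSubmonoid.subset_closure ⟨i, hi, rfl⟩

theorem weightLE_sub_root {i : H.root} (hi : b.IsPos i) (μ : Module.Dual ℂ H) :
    WeightLE b (-i.1.toLinear + μ) μ := by
  simpa using weightLE_add_root hi (-i.1.toLinear + μ)

variable (b) in
/-- A linear form on `H*` that is the height on the roots. -/
theorem exists_height : ∃ f : Module.Dual ℂ H →ₗ[ℂ] ℂ, ∀ i : H.root, f i.1.toLinear = b.height i := by
  refine ⟨b.toWeightBasis.constr ℂ fun _ => 1, fun i => ?_⟩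
  obtain ⟨f, -, -, hf⟩ := b.exists_root_eq_sum_int i
  rw [RootPairing.Base.height_eq_sum hf]
  have h : i.1.toLinear = (IsKilling.rootSystem H).root i := rfl
  rw [h, hf, map_sum, Int.cast_sum]
  refine Finset.sum_congr rfl fun j hj => ?_
  rw [map_zsmul, ← b.toWeightBasis_apply ⟨j, hj⟩, Module.Basis.constr_basis]
  simp

/-- Every positive root has height at least one, so only the empty sum has height zero. This turns
order statements about weights into arithmetic of natural numbers. -/
theorem height_of_mem_closure {f : Module.Dual ℂ H →ₗ[ℂ] ℂ}
    (hf : ∀ i : H.root, f i.1.toLinear = b.height i) {β : Module.Dual ℂ H}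
    (hβ : β ∈ AddSubmonoid.closure {β | ∃ i, b.IsPos i ∧ β = (IsKilling.rootSystem H).root i}) :
    ∃ n : ℕ, f β = n ∧ (n = 0 → β = 0) := by
  induction hβ using AddSubmonoid.closure_induction with
  | zero => exact ⟨0, by simp, fun _ => rfl⟩
  | mem β hβ =>
    obtain ⟨i, hi, rfl⟩ := hβ
    have hpos : 0 < b.height i := hi
    refine ⟨(b.height i).toNat, ?_, fun h => by omega⟩
    change f i.1.toLinear = _
    rw [hf, ← Int.cast_natCast, Int.toNat_of_nonneg hpos.le]
  | add β γ _ _ h h' =>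
    obtain ⟨m, hm, hm'⟩ := h
    obtain ⟨n, hn, hn'⟩ := h'
    refine ⟨m + n, by rw [map_add, hm, hn, Nat.cast_add], fun h => ?_⟩
    rw [hm' (by omega), hn' (by omega), add_zero]

theorem WeightLE.antisymm {μ ν : Module.Dual ℂ H} (h : WeightLE b μ ν) (h' : WeightLE b ν μ) :
    μ = ν := by
  obtain ⟨f, hf⟩ := exists_height b
  obtain ⟨m, hm, hm'⟩ := height_of_mem_closure hf h
  obtain ⟨n, hn, -⟩ := height_of_mem_closure hf h'
  have : ((m + n : ℕ) : ℂ) = 0 := by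
    rw [Nat.cast_add, ← hm, ← hn, ← map_add]
    simp
  have hmn : m + n = 0 := by exact_mod_cast this
  exact (sub_eq_zero.1 (hm' (by omega))).symm

/-- Induction on `n`: a nonzero sum of positive roots is a positive root plus a sum of smaller
height, and there are finitely many roots. -/
theorem finite_closure_height_le {f : Module.Dual ℂ H →ₗ[ℂ] ℂ}
    (hf : ∀ i : H.root, f i.1.toLinear = b.height i) (n : ℕ) :
    {β | β ∈ AddSubmonoid.closure {β | ∃ i, b.IsPos i ∧ β = (IsKilling.rootSystem H).root i} ∧
      ∃ m ≤ n, f β = (m : ℕ)}.Finite := by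
  set S := {β : Module.Dual ℂ H | ∃ i, b.IsPos i ∧ β = (IsKilling.rootSystem H).root i} with hS
  have hSfin : S.Finite := (Set.finite_range (IsKilling.rootSystem H).root).subset (by
    rintro _ ⟨i, -, rfl⟩; exact ⟨i, rfl⟩)
  induction n with
  | zero =>
    refine (Set.finite_singleton 0).subset ?_
    rintro β ⟨hβ, m, hm, hfm⟩
    obtain ⟨k, hk, hk'⟩ := height_of_mem_closure hf hβ
    rw [hfm, Nat.cast_inj] at hk
    exact hk' (by omega)
  | succ n ih =>
    refine ((ih.add hSfin).union (Set.finite_singleton 0)).subset ?_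
    rintro β ⟨hβ, m, hm, hfm⟩
    by_cases h0 : β = 0
    · exact Or.inr h0
    refine Or.inl ?_
    obtain ⟨γ, hγ, δ, hδ, rfl⟩ : ∃ γ ∈ AddSubmonoid.closure S, ∃ δ ∈ S, γ + δ = β := by
      clear hfm
      induction hβ using AddSubmonoid.closure_induction with
      | zero => exact absurd rfl h0
      | mem β h => exact ⟨0, zero_mem _, β, h, zero_add β⟩
      | add β β' hβ hβ' h h' =>
        by_cases h1 : β' = 0
        · subst h1
          rw [add_zero] at h0 ⊢
          exact h h0
        · obtain ⟨γ, hγ, δ, hδ, e⟩ := h' h1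
          exact ⟨β + γ, add_mem hβ hγ, δ, hδ, by rw [add_assoc, e]⟩
    refine ⟨γ, ⟨hγ, ?_⟩, δ, hδ, rfl⟩
    obtain ⟨k, hk, -⟩ := height_of_mem_closure hf hγ
    obtain ⟨l, hl, -⟩ := height_of_mem_closure hf (AddSubmonoid.subset_closure hδ)
    obtain ⟨i, hi, rfl⟩ := hδ
    have hpos : 0 < b.height i := hi
    have hl' : (l : ℂ) = b.height i := by rw [← hl]; exact hf i
    have hl'' : (l : ℤ) = b.height i := by exact_mod_cast hl'
    rw [map_add, hk, hl, ← Nat.cast_add, Nat.cast_inj] at hfm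
    exact ⟨k, by omega, hk⟩

/-- Intervals for the weight order are finite. -/
theorem finite_weightLE_interval (μ ν : Module.Dual ℂ H) :
    {ξ | WeightLE b μ ξ ∧ WeightLE b ξ ν}.Finite := by
  obtain ⟨f, hf⟩ := exists_height b
  by_cases hμν : WeightLE b μ ν
  · obtain ⟨n, hn, -⟩ := height_of_mem_closure hf hμν
    refine ((finite_closure_height_le hf n).image fun β => β + μ).subset ?_
    rintro ξ ⟨h1, h2⟩
    refine ⟨ξ - μ, ⟨h1, ?_⟩, sub_add_cancel _ _⟩
    obtain ⟨k, hk, -⟩ := height_of_mem_closure hf h1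
    obtain ⟨l, hl, -⟩ := height_of_mem_closure hf h2
    refine ⟨k, ?_, hk⟩
    have : ((k + l : ℕ) : ℂ) = (n : ℕ) := by
      rw [Nat.cast_add, ← hk, ← hl, ← hn, ← map_add]
      congr 1
      abel
    have : k + l = n := by exact_mod_cast this
    omega
  · refine Set.finite_empty.subset ?_
    rintro ξ ⟨h1, h2⟩
    exact hμν (h1.trans h2)

end Order

/-! ### Root vectors and weight spaces -/

section RootVectors

variable (b : (IsKilling.rootSystem H).Base)

theorem rootSpace_neg_mem_nMinus {i : H.root} (hi : b.IsPos i) {x : 𝔤}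
    (hx : x ∈ rootSpace H (-(i.1 : H → ℂ))) : x ∈ nMinus b := by
  change x ∈ ⨆ i : {i : H.root // b.IsPos i}, (rootSpace H (-(i.1.1 : H → ℂ))).toSubmodule
  exact Submodule.mem_iSup_of_mem ⟨i, hi⟩ hx

/-- A subspace that contains the negative root vectors contains `𝔫₋`. -/
theorem nMinus_le {p : Submodule ℂ 𝔤}
    (hp : ∀ i, b.IsPos i → ∀ x ∈ rootSpace H (-(i.1 : H → ℂ)), x ∈ p) (y : nMinus b) :
    (y : 𝔤) ∈ p := by
  have hy : (y : 𝔤) ∈ ⨆ i : {i : H.root // b.IsPos i},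
    (rootSpace H (-(i.1.1 : H → ℂ))).toSubmodule := y.2
  have hle : ⨆ i : {i : H.root // b.IsPos i}, (rootSpace H (-(i.1.1 : H → ℂ))).toSubmodule ≤ p :=
    iSup_le fun i => hp i.1 i.2
  exact hle hy

theorem mem_of_mem_rootSpace_zero {x : 𝔤} (hx : x ∈ rootSpace H (0 : H → ℂ)) : x ∈ H := by
  rw [rootSpace_zero_eq] at hx
  exact hx

theorem weight_cases (α : Weight ℂ H 𝔤) :
    (∃ i, b.IsPos i ∧ (α : H → ℂ) = -(i.1 : H → ℂ)) ∨ (α : H → ℂ) = 0 ∨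
      ∃ i, b.IsPos i ∧ (α : H → ℂ) = (i.1 : H → ℂ) := by
  by_cases h0 : (α : H → ℂ) = 0
  · exact Or.inr (Or.inl h0)
  · let P := IsKilling.rootSystem H
    let _ := P.indexNeg
    let i : H.root := ⟨α, by simpa using fun h : α.IsZero => h0 h⟩
    rcases RootPairing.Base.IsPos.or_neg b i with h | h
    · exact Or.inr (Or.inr ⟨i, h, rfl⟩)
    · refine Or.inl ⟨-i, h, ?_⟩
      have h : P.root (-i) = -P.root i := by simp
      funext t
      have h' : ((-i).1 : H → ℂ) t = -(α t) := DFunLike.congr_fun h t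
      rw [Pi.neg_apply, h', neg_neg]

/-- The triangular decomposition: `𝔤` is spanned by `H` and the root vectors. -/
theorem triangular_induction {p : Submodule ℂ 𝔤}
    (hneg : ∀ i, b.IsPos i → ∀ x ∈ rootSpace H (-(i.1 : H → ℂ)), x ∈ p)
    (hzero : ∀ h : H, (h : 𝔤) ∈ p)
    (hpos : ∀ i, b.IsPos i → ∀ x ∈ rootSpace H (i.1 : H → ℂ), x ∈ p) (x : 𝔤) : x ∈ p := by
  have hx : x ∈ ⨆ α : Weight ℂ H 𝔤, (rootSpace H (α : H → ℂ)).toSubmodule := by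
    rw [← LieSubmodule.iSup_toSubmodule, LieModule.iSup_genWeightSpace_eq_top' ℂ H 𝔤]
    trivial
  have hle : ⨆ α : Weight ℂ H 𝔤, (rootSpace H (α : H → ℂ)).toSubmodule ≤ p := by
    refine iSup_le fun α y hy => ?_
    rcases weight_cases b α with ⟨i, hi, h⟩ | h | ⟨i, hi, h⟩ <;> rw [h] at hy
    · exact hneg i hi y hy
    · exact hzero ⟨y, mem_of_mem_rootSpace_zero hy⟩
    · exact hpos i hi y hy
  exact hle hx

end RootVectors

section WeightSpaces

variable {M : Type*} [AddCommGroup M] [Module ℂ M] [LieRingModule 𝔤 M] [LieModule ℂ 𝔤 M]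

variable (H M) in
/-- The weight space of weight `μ`, as a subspace. -/
def wtSpace (μ : Module.Dual ℂ H) : Submodule ℂ M :=
  (weightSpace M (μ : H → ℂ) : LieSubmodule ℂ H M).toSubmodule

theorem mem_wtSpace {μ : Module.Dual ℂ H} {m : M} :
    m ∈ wtSpace H M μ ↔ ∀ h : H, ⁅(h : 𝔤), m⁆ = μ h • m :=
  mem_weightSpace (μ : H → ℂ) m

theorem isWeightModule_iff : IsWeightModule H M ↔ ⨆ μ, wtSpace H M μ = ⊤ := by
  rw [IsWeightModule, ← LieSubmodule.toSubmodule_inj, LieSubmodule.iSup_toSubmodule]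
  rfl

variable (H M) in
theorem iSupIndep_wtSpace : iSupIndep (wtSpace H M) := by
  have h := (iSupIndep_genWeightSpace ℂ H M).comp
    (DFunLike.coe_injective : Function.Injective fun μ : Module.Dual ℂ H => (μ : H → ℂ))
  rw [← LieSubmodule.iSupIndep_toSubmodule] at h
  exact h.mono fun μ => weightSpace_le_genWeightSpace M (μ : H → ℂ)

theorem lie_mem_wtSpace {α μ : Module.Dual ℂ H} {x : 𝔤} {m : M}
    (hx : x ∈ rootSpace H (α : H → ℂ)) (hm : m ∈ wtSpace H M μ) :
    ⁅x, m⁆ ∈ wtSpace H M (α + μ) := by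
  rw [mem_wtSpace] at hm ⊢
  intro h
  have h1 : ⁅(h : 𝔤), x⁆ = α h • x := LieAlgebra.IsKilling.lie_eq_smul_of_mem_rootSpace hx h
  rw [leibniz_lie, h1, hm h, smul_lie, lie_smul, LinearMap.add_apply, add_smul]

theorem lie_mem_wtSpace_pos {i : H.root} {μ : Module.Dual ℂ H} {x : 𝔤} {m : M}
    (hx : x ∈ rootSpace H (i.1 : H → ℂ)) (hm : m ∈ wtSpace H M μ) :
    ⁅x, m⁆ ∈ wtSpace H M (i.1.toLinear + μ) :=
  lie_mem_wtSpace (α := i.1.toLinear) hx hm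

theorem lie_mem_wtSpace_neg {i : H.root} {μ : Module.Dual ℂ H} {x : 𝔤} {m : M}
    (hx : x ∈ rootSpace H (-(i.1 : H → ℂ))) (hm : m ∈ wtSpace H M μ) :
    ⁅x, m⁆ ∈ wtSpace H M (-i.1.toLinear + μ) :=
  lie_mem_wtSpace (α := -i.1.toLinear) hx hm

theorem map_mem_wtSpace {M' : Type*} [AddCommGroup M'] [Module ℂ M'] [LieRingModule 𝔤 M']
    [LieModule ℂ 𝔤 M'] (f : M →ₗ⁅ℂ, 𝔤⁆ M') {μ : Module.Dual ℂ H} {m : M}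
    (hm : m ∈ wtSpace H M μ) : f m ∈ wtSpace H M' μ := by
  rw [mem_wtSpace] at hm ⊢
  intro h
  rw [← LieModuleHom.map_lie, hm h, map_smul]

/-- Weight vectors lift along quotients of weight modules. -/
theorem exists_wtSpace_lift {M' : Type*} [AddCommGroup M'] [Module ℂ M'] [LieRingModule 𝔤 M']
    [LieModule ℂ 𝔤 M'] (f : M →ₗ⁅ℂ, 𝔤⁆ M') (hf : Function.Surjective f) (hM : IsWeightModule H M)
    {μ : Module.Dual ℂ H} {m' : M'} (hm' : m' ∈ wtSpace H M' μ) :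
    ∃ m ∈ wtSpace H M μ, f m = m' := by
  -- The images of the weight spaces of `M` lie in the weight spaces of `M'` and span `M'`, so by
  -- independence they fill them.
  have h := eq_of_le_of_iSup_eq_top (iSupIndep_wtSpace H M')
    (g := fun μ => (wtSpace H M μ).map (f : M →ₗ[ℂ] M')) (fun μ => by
      rintro _ ⟨m, hm, rfl⟩; exact map_mem_wtSpace f hm) (by
      rw [← Submodule.map_iSup, isWeightModule_iff.1 hM, Submodule.map_top, LinearMap.range_eq_top]
      exact hf) μ
  rw [← h] at hm'
  exact hm'

end WeightSpaces

end Weights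

section Weights

attribute [local instance] envModule envModule_isScalarTower

local notation "𝒰" => UniversalEnvelopingAlgebra ℂ
local notation "ιᵤ" => UniversalEnvelopingAlgebra.ι ℂ

variable {𝔤 : Type*} [LieRing 𝔤] [LieAlgebra ℂ 𝔤] [FiniteDimensional ℂ 𝔤]
  [LieAlgebra.IsSemisimple ℂ 𝔤] {H : LieSubalgebra ℂ 𝔤} [H.IsCartanSubalgebra]
  (b : (IsKilling.rootSystem H).Base)

/-! ### Modules generated over `U(𝔫₋)` by weight vectors. -/

section Generators

variable {M : Type*} [AddCommGroup M] [Module ℂ M] [LieRingModule 𝔤 M] [LieModule ℂ 𝔤 M]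

/-- The linear map `x ↦ ⁅x, m⁆`. -/
def lieFlip (m : M) : 𝔤 →ₗ[ℂ] M where
  toFun x := ⁅x, m⁆
  map_add' x y := add_lie x y m
  map_smul' c x := smul_lie c x m

variable {b} in
/-- A subspace stable under the negative root vectors is stable under `𝔫₋`. -/
theorem nMinus_lie_mem {p : Submodule ℂ M}
    (hp : ∀ i, b.IsPos i → ∀ x ∈ rootSpace H (-(i.1 : H → ℂ)), ∀ m ∈ p, ⁅x, m⁆ ∈ p)
    (y : nMinus b) (m : M) (hm : m ∈ p) : ⁅y, m⁆ ∈ p := by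
  have := nMinus_le b (p := p.comap (lieFlip m))
    (fun i hi x hx => hp i hi x hx m hm) y
  exact this

/-- A `U(n)`-submodule that contains `⁅x, s⁆` for all generators `s` is stable under the whole
Lie algebra. -/
theorem lie_mem_span {n : LieSubalgebra ℂ 𝔤} {S : Set M}
    (hS : ∀ x : 𝔤, ∀ s ∈ S, ⁅x, s⁆ ∈ Submodule.span (𝒰 n) S) (x : 𝔤) {m : M}
    (hm : m ∈ Submodule.span (𝒰 n) S) : ⁅x, m⁆ ∈ Submodule.span (𝒰 n) S := by
  set P := Submodule.span (𝒰 n) S with hP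
  -- For `y` in `n`, `x(ym) = [x,y]m + y(xm)`. The bracket `[x,y]` may be any element of `𝔤`, so the
  -- condition has to be imposed for all `x` at once.
  let q : Submodule ℂ M :=
    { carrier := {m | m ∈ P ∧ ∀ x : 𝔤, ⁅x, m⁆ ∈ P}
      add_mem' := fun {a c} ha hc => ⟨P.add_mem ha.1 hc.1, fun x => by
        rw [lie_add]; exact P.add_mem (ha.2 x) (hc.2 x)⟩
      zero_mem' := ⟨P.zero_mem, fun x => by rw [lie_zero]; exact P.zero_mem⟩
      smul_mem' := fun c a ha => ⟨smul_mem_of_mem P c ha.1, fun x => by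
        rw [lie_smul]; exact smul_mem_of_mem P c (ha.2 x)⟩ }
  have hq : ∀ (y : n), ∀ m ∈ q, ⁅y, m⁆ ∈ q := fun y m hm =>
    ⟨lie_mem_of_mem P y hm.1, fun x => by
      rw [LieSubalgebra.coe_bracket_of_module, leibniz_lie]
      exact P.add_mem (hm.2 _) (lie_mem_of_mem P y (hm.2 x))⟩
  have hle : P ≤ envSubmodule q hq :=
    Submodule.span_le.2 fun s hs => ⟨Submodule.subset_span hs, fun x => hS x s hs⟩
  exact (hle hm).2 x

/-- The `𝔤`-submodule generated over `U(𝔫₋)` by weight vectors, when this is stable under the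
positive root vectors. -/
def spanLie {I : Type*} {v : I → M} {κ : I → Module.Dual ℂ H} (hv : ∀ i, v i ∈ wtSpace H M (κ i))
    (s : Set I) (hs : ∀ j, b.IsPos j → ∀ x ∈ rootSpace H (j.1 : H → ℂ), ∀ i ∈ s,
      ⁅x, v i⁆ ∈ Submodule.span (𝒰 (nMinus b)) (v '' s)) : LieSubmodule ℂ 𝔤 M where
  toSubmodule := (Submodule.span (𝒰 (nMinus b)) (v '' s)).restrictScalars ℂ
  lie_mem {x m} hm := by
    refine lie_mem_span (S := v '' s) ?_ x hm
    rintro x _ ⟨i, hi, rfl⟩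
    set P := Submodule.span (𝒰 (nMinus b)) (v '' s) with hP
    have hvi : v i ∈ P := Submodule.subset_span ⟨i, hi, rfl⟩
    refine triangular_induction b (p := (P.restrictScalars ℂ).comap
      (lieFlip (v i))) ?_ ?_ ?_ x
    · intro j hj x hx
      exact lie_mem_of_mem P (⟨x, rootSpace_neg_mem_nMinus b hj hx⟩ : nMinus b) hvi
    · intro h
      change ⁅(h : 𝔤), v i⁆ ∈ P
      rw [mem_wtSpace.1 (hv i) h]
      exact smul_mem_of_mem P _ hvi
    · exact fun j hj x hx => hs j hj x hx i hi

variable {b}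

/-- A module generated over `U(𝔫₋)` by weight vectors is a weight module; more precisely, a vector
whose weight lies in an upper set is generated by the generators whose weights lie in it. -/
theorem mem_span_of_mem_wtSpace {I : Type*} {v : I → M} {κ : I → Module.Dual ℂ H}
    (hv : ∀ i, v i ∈ wtSpace H M (κ i))
    (hspan : Submodule.span (𝒰 (nMinus b)) (Set.range v) = ⊤) {U : Set (Module.Dual ℂ H)}
    (hU : ∀ μ ν, WeightLE b μ ν → μ ∈ U → ν ∈ U) {μ : Module.Dual ℂ H} (hμ : μ ∈ U) {m : M}
    (hm : m ∈ wtSpace H M μ) :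
    m ∈ Submodule.span (𝒰 (nMinus b)) (v '' {i | κ i ∈ U}) := by
  classical
  set P := Submodule.span (𝒰 (nMinus b)) (v '' {i | κ i ∈ U}) with hP
  -- Weight spaces are cut down to `P` only over `U`. If a negative root vector lands in a weight of
  -- `U`, it started from one, so the sum of the `g ν` is stable under `𝔫₋`. It contains all
  -- generators, hence is everything, and independence gives `g μ = wtSpace H M μ`.
  let g : Module.Dual ℂ H → Submodule ℂ M := fun ν =>
    if ν ∈ U then P.restrictScalars ℂ ⊓ wtSpace H M ν else wtSpace H M ν
  have hgle : ∀ ν, g ν ≤ wtSpace H M ν := fun ν => by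
    by_cases h : ν ∈ U
    · simp only [g, if_pos h]; exact inf_le_right
    · simp only [g, if_neg h]; exact le_rfl
  have hstable : ∀ (y : nMinus b), ∀ m ∈ ⨆ ν, g ν, ⁅y, m⁆ ∈ ⨆ ν, g ν := by
    refine nMinus_lie_mem fun i hi x hx m hm => ?_
    induction hm using Submodule.iSup_induction' with
    | zero => rw [lie_zero]; exact zero_mem _
    | add m m' _ _ h h' => rw [lie_add]; exact add_mem h h'
    | mem ν m hm =>
      refine Submodule.mem_iSup_of_mem (-i.1.toLinear + ν) ?_
      have hw := lie_mem_wtSpace_neg hx (hgle ν hm)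
      by_cases h : -i.1.toLinear + ν ∈ U
      · have hν : ν ∈ U := hU _ _ (weightLE_sub_root hi ν) h
        simp only [g, if_pos hν] at hm
        simp only [g, if_pos h]
        exact ⟨lie_mem_of_mem P (⟨x, rootSpace_neg_mem_nMinus b hi hx⟩ : nMinus b) hm.1, hw⟩
      · simp only [g, if_neg h]
        exact hw
  have htop : ⨆ ν, g ν = ⊤ := by
    have h : envSubmodule (⨆ ν, g ν) hstable = ⊤ := by
      rw [eq_top_iff, ← hspan, Submodule.span_le]
      rintro _ ⟨i, rfl⟩
      refine Submodule.mem_iSup_of_mem (κ i) ?_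
      by_cases h : κ i ∈ U
      · simp only [g, if_pos h]
        exact ⟨Submodule.subset_span ⟨i, h, rfl⟩, hv i⟩
      · simp only [g, if_neg h]
        exact hv i
    refine eq_top_iff.2 fun m _ => ?_
    have : m ∈ envSubmodule (⨆ ν, g ν) hstable := by rw [h]; trivial
    exact this
  have h := eq_of_le_of_iSup_eq_top (iSupIndep_wtSpace H M) hgle htop μ
  rw [← h] at hm
  simp only [g, if_pos hμ] at hm
  exact hm.1

/-- Negative root vectors permute weight spaces by a shift, so the sum of the weight spaces is a
`U(𝔫₋)`-submodule that contains the generators. -/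
theorem isWeightModule_of_span {I : Type*} {v : I → M} {κ : I → Module.Dual ℂ H}
    (hv : ∀ i, v i ∈ wtSpace H M (κ i))
    (hspan : Submodule.span (𝒰 (nMinus b)) (Set.range v) = ⊤) : IsWeightModule H M := by
  rw [isWeightModule_iff]
  have hstable : ∀ (y : nMinus b), ∀ m ∈ ⨆ ν, wtSpace H M ν, ⁅y, m⁆ ∈ ⨆ ν, wtSpace H M ν := by
    refine nMinus_lie_mem fun i hi x hx m hm => ?_
    induction hm using Submodule.iSup_induction' with
    | zero => rw [lie_zero]; exact zero_mem _
    | add m m' _ _ h h' => rw [lie_add]; exact add_mem h h'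
    | mem ν m hm =>
      exact Submodule.mem_iSup_of_mem (-i.1.toLinear + ν) (lie_mem_wtSpace_neg hx hm)
  have h : envSubmodule (⨆ ν, wtSpace H M ν) hstable = ⊤ := by
    rw [eq_top_iff, ← hspan, Submodule.span_le]
    rintro _ ⟨i, rfl⟩
    exact Submodule.mem_iSup_of_mem (κ i) (hv i)
  refine eq_top_iff.2 fun m _ => ?_
  have : m ∈ envSubmodule (⨆ ν, wtSpace H M ν) hstable := by rw [h]; trivial
  exact this

end Generators

/-! ### Verma modules -/

section VermaModules

variable {b} in
theorem root_ne_zero_of_isPos {i : H.root} (hi : b.IsPos i) : (i.1 : H → ℂ) ≠ 0 := by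
  intro h
  obtain ⟨f, hf⟩ := exists_height b
  have h' : i.1.toLinear = 0 := DFunLike.coe_injective h
  have := hf i
  rw [h', map_zero] at this
  have h0 : b.height i = 0 := by exact_mod_cast this.symm
  have hpos : 0 < b.height i := hi
  omega

variable {b} in
theorem root_ne_neg_of_isPos {i j : H.root} (hi : b.IsPos i) (hj : b.IsPos j) :
    (i.1 : H → ℂ) ≠ -(j.1 : H → ℂ) := by
  intro h
  obtain ⟨f, hf⟩ := exists_height b
  have h' : i.1.toLinear = -j.1.toLinear := DFunLike.coe_injective h
  have := hf i
  rw [h', map_neg, hf j] at this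
  have h0 : -b.height j = b.height i := by exact_mod_cast this
  have hpos : 0 < b.height i := hi
  have hpos' : 0 < b.height j := hj
  omega

/-- The linear map `𝔤 → U(𝔫₋)` that is the inclusion on `𝔫₋`, the weight on `H` and zero on
`𝔫₊`. -/
theorem exists_verma_cocycle (wt : Module.Dual ℂ H) : ∃ φ : 𝔤 →ₗ[ℂ] 𝒰 (nMinus b),
    (∀ y : nMinus b, φ y = ιᵤ y) ∧ (∀ h : H, φ h = wt h • 1) ∧
    ∀ i, b.IsPos i → ∀ x ∈ rootSpace H (i.1 : H → ℂ), φ x = 0 := by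
  classical
  have hsup : ⨆ α : Weight ℂ H 𝔤, (rootSpace H (α : H → ℂ)).toSubmodule = ⊤ := by
    rw [← LieSubmodule.iSup_toSubmodule, LieModule.iSup_genWeightSpace_eq_top' ℂ H 𝔤]
    rfl
  have hind : iSupIndep fun α : Weight ℂ H 𝔤 => (rootSpace H (α : H → ℂ)).toSubmodule :=
    LieSubmodule.iSupIndep_toSubmodule.2 (iSupIndep_genWeightSpace' ℂ H 𝔤)
  let f (α : Weight ℂ H 𝔤) : (rootSpace H (α : H → ℂ)).toSubmodule →ₗ[ℂ] 𝒰 (nMinus b) :=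
    if h : ∃ i, b.IsPos i ∧ (α : H → ℂ) = -(i.1 : H → ℂ) then
      LinearMap.comp
        { toFun := ιᵤ, map_add' := map_add (ιᵤ), map_smul' := map_smul (ιᵤ) }
        (Submodule.inclusion (p' := (nMinus b).toSubmodule) (by
          obtain ⟨i, hi, h⟩ := h
          intro x hx
          rw [h] at hx
          exact rootSpace_neg_mem_nMinus b hi hx))
    else if h : (α : H → ℂ) = 0 then
      (LinearMap.toSpanSingleton ℂ (𝒰 (nMinus b)) 1).comp
        (LinearMap.comp wt (Submodule.inclusion (p' := H.toSubmodule) (by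
          intro x hx
          rw [h] at hx
          exact mem_of_mem_rootSpace_zero hx)))
    else 0
  obtain ⟨φ, hφ⟩ := exists_linearMap_of_iSupIndep hind hsup f
  refine ⟨φ, ?_, ?_, ?_⟩
  · intro y
    obtain ⟨y, hy⟩ := y
    have key : ∀ i, b.IsPos i → ∀ x ∈ rootSpace H (-(i.1 : H → ℂ)), ∃ hx : x ∈ nMinus b,
        φ x = ιᵤ (⟨x, hx⟩ : nMinus b) := by
      intro i hi x hx
      refine ⟨rootSpace_neg_mem_nMinus b hi hx, ?_⟩
      -- `φ` is prescribed on bundled weights, whose spaces are nonzero by definition; a zero space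
      -- is treated apart.
      by_cases h0 : rootSpace H (-(i.1 : H → ℂ)) = ⊥
      · rw [h0, LieSubmodule.mem_bot] at hx
        subst hx
        rw [map_zero]
        exact (map_zero _).symm
      · let α : Weight ℂ H 𝔤 := ⟨_, h0⟩
        have := hφ α ⟨x, hx⟩
        rw [this]
        have h : ∃ j, b.IsPos j ∧ (α : H → ℂ) = -(j.1 : H → ℂ) := ⟨i, hi, rfl⟩
        simp only [f, dif_pos h]
        rfl
    let p : Submodule ℂ 𝔤 :=
      { carrier := {x | ∃ hx : x ∈ nMinus b, φ x = ιᵤ (⟨x, hx⟩ : nMinus b)}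
        add_mem' := by
          rintro x x' ⟨hx, e⟩ ⟨hx', e'⟩
          refine ⟨add_mem hx hx', ?_⟩
          rw [map_add, e, e', ← map_add]
          rfl
        zero_mem' := ⟨zero_mem _, by rw [map_zero]; exact (map_zero _).symm⟩
        smul_mem' := by
          rintro c x ⟨hx, e⟩
          refine ⟨(nMinus b).smul_mem c hx, ?_⟩
          rw [map_smul, e, ← map_smul]
          rfl }
    exact (nMinus_le b (p := p) key ⟨y, hy⟩).2
  · intro h
    by_cases h0 : rootSpace H (0 : H → ℂ) = ⊥
    · have hh : (h : 𝔤) ∈ rootSpace H (0 : H → ℂ) := by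
        rw [rootSpace_zero_eq]; exact h.2
      rw [h0, LieSubmodule.mem_bot] at hh
      have : h = 0 := Subtype.ext hh
      subst this
      simp
    · let α : Weight ℂ H 𝔤 := ⟨_, h0⟩
      have hh : (h : 𝔤) ∈ rootSpace H (α : H → ℂ) := by
        change _ ∈ rootSpace H (0 : H → ℂ)
        rw [rootSpace_zero_eq]; exact h.2
      rw [hφ α ⟨h, hh⟩]
      have h1 : ¬ ∃ j, b.IsPos j ∧ (α : H → ℂ) = -(j.1 : H → ℂ) := by
        rintro ⟨j, hj, e⟩
        exact root_ne_zero_of_isPos hj (neg_eq_zero.1 e.symm)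
      have h2 : (α : H → ℂ) = 0 := rfl
      simp only [f, dif_neg h1, dif_pos h2]
      rfl
  · intro i hi x hx
    rw [hφ i.1 ⟨x, hx⟩]
    have h1 : ¬ ∃ j, b.IsPos j ∧ (i.1 : H → ℂ) = -(j.1 : H → ℂ) := by
      rintro ⟨j, hj, e⟩
      exact root_ne_neg_of_isPos hi hj e
    simp only [f, dif_neg h1, dif_neg (root_ne_zero_of_isPos hi)]
    rfl

/-- `H` and the positive root vectors. -/
def borelGenerators : Set 𝔤 :=
  {x | (∃ h : H, x = h) ∨ ∃ i, b.IsPos i ∧ x ∈ rootSpace H (i.1 : H → ℂ)}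

/-- `U(𝔫₋)` is a `𝔤`-module whose generator `1` is a highest weight vector of weight `wt`. -/
theorem exists_verma_action (wt : Module.Dual ℂ H) :
    ∃ ρ : 𝒰 𝔤 →ₐ[ℂ] Module.End ℂ (𝒰 (nMinus b)),
      (∀ (y : nMinus b) u, ρ (ιᵤ (y : 𝔤)) u = ιᵤ y * u) ∧ (∀ h : H, ρ (ιᵤ (h : 𝔤)) 1 = wt h • 1) ∧
      ∀ i, b.IsPos i → ∀ x ∈ rootSpace H (i.1 : H → ℂ), ρ (ιᵤ x) 1 = 0 := by
  obtain ⟨φ, hφ, hφH, hφp⟩ := exists_verma_cocycle b wt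
  have hHH (h h' : H) : ⁅(h : 𝔤), (h' : 𝔤)⁆ = 0 := by
    have hh : (h' : 𝔤) ∈ rootSpace H (0 : H → ℂ) := by rw [rootSpace_zero_eq]; exact h'.2
    have : ⁅(h : 𝔤), (h' : 𝔤)⁆ = (0 : H → ℂ) h • (h' : 𝔤) :=
      LieAlgebra.IsKilling.lie_eq_smul_of_mem_rootSpace hh h
    rw [this, Pi.zero_apply, zero_smul]
  have hHx (h : H) {i : H.root} (hi : b.IsPos i) {x : 𝔤} (hx : x ∈ rootSpace H (i.1 : H → ℂ)) :
      φ ⁅(h : 𝔤), x⁆ = 0 := by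
    have : ⁅(h : 𝔤), x⁆ = (i.1 : H → ℂ) h • x :=
      LieAlgebra.IsKilling.lie_eq_smul_of_mem_rootSpace hx h
    rw [this, map_smul, hφp i hi x hx, smul_zero]
  have hxx {i j : H.root} (hi : b.IsPos i) (hj : b.IsPos j) {x y : 𝔤}
      (hx : x ∈ rootSpace H (i.1 : H → ℂ)) (hy : y ∈ rootSpace H (j.1 : H → ℂ)) :
      φ ⁅x, y⁆ = 0 := by
    have hxy : ⁅x, y⁆ ∈ rootSpace H ((i.1 : H → ℂ) + (j.1 : H → ℂ)) :=
      lie_mem_genWeightSpace_of_mem_genWeightSpace hx hy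
    by_cases h0 : rootSpace H ((i.1 : H → ℂ) + (j.1 : H → ℂ)) = ⊥
    · rw [h0, LieSubmodule.mem_bot] at hxy
      rw [hxy, map_zero]
    · rcases weight_cases b ⟨_, h0⟩ with ⟨k, hk, e⟩ | e | ⟨k, hk, e⟩
      -- A sum of two positive roots has positive height, so it is not the negative of a positive
      -- root.
      · obtain ⟨f, hf⟩ := exists_height b
        have e' : i.1.toLinear + j.1.toLinear = -k.1.toLinear := DFunLike.coe_injective e
        have e'' := congrArg f e'
        rw [map_add, map_neg, hf, hf, hf] at e''
        have e3 : b.height i + b.height j = -b.height k := by exact_mod_cast e''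
        have h1 : 0 < b.height i := hi
        have h2 : 0 < b.height j := hj
        have h3 : 0 < b.height k := hk
        omega
      · exact absurd (eq_neg_of_add_eq_zero_left e) (root_ne_neg_of_isPos hi hj)
      · refine hφp k hk _ ?_
        rw [← e]
        exact hxy
  have hgen : ∀ x ∈ borelGenerators b, ∀ y ∈ borelGenerators b, φ ⁅x, y⁆ = 0 := by
    rintro x (⟨h, rfl⟩ | ⟨i, hi, hx⟩) y (⟨h', rfl⟩ | ⟨j, hj, hy⟩)
    · rw [hHH, map_zero]
    · exact hHx h hj hy
    · rw [← lie_skew, map_neg, hHx h' hi hx, neg_zero]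
    · exact hxx hi hj hx hy
  have hsplit : ∀ z : 𝔤, ∃ y : nMinus b, ∃ x ∈ Submodule.span ℂ (borelGenerators b), z = y + x := by
    have key : ∀ z : 𝔤, z ∈ (nMinus b).toSubmodule ⊔ Submodule.span ℂ (borelGenerators b) :=
      triangular_induction b
        (fun i hi x hx => Submodule.mem_sup_left (rootSpace_neg_mem_nMinus b hi hx))
        (fun h => Submodule.mem_sup_right (Submodule.subset_span (Or.inl ⟨h, rfl⟩)))
        (fun i hi x hx => Submodule.mem_sup_right (Submodule.subset_span (Or.inr ⟨i, hi, hx⟩)))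
    intro z
    obtain ⟨y, hy, x, hx, e⟩ := Submodule.mem_sup.1 (key z)
    exact ⟨⟨y, hy⟩, x, hx, e.symm⟩
  have hscalar : ∀ x ∈ Submodule.span ℂ (borelGenerators b),
      φ x ∈ Submodule.span ℂ {(1 : 𝒰 (nMinus b))} := by
    intro x hx
    have hle : Submodule.span ℂ (borelGenerators b) ≤
        (Submodule.span ℂ {(1 : 𝒰 (nMinus b))}).comap φ := by
      rw [Submodule.span_le]
      rintro x (⟨h, rfl⟩ | ⟨i, hi, hx⟩)
      · exact Submodule.mem_span_singleton.2 ⟨wt h, (hφH h).symm⟩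
      · rw [SetLike.mem_coe, Submodule.mem_comap]
        rw [hφp i hi x hx]
        exact zero_mem _
    exact hle hx
  have hbracket : ∀ x ∈ Submodule.span ℂ (borelGenerators b),
      ∀ y ∈ Submodule.span ℂ (borelGenerators b), φ ⁅x, y⁆ = 0 := by
    intro x hx y hy
    induction hx using Submodule.span_induction with
    | zero => rw [zero_lie, map_zero]
    | add x x' _ _ h h' => rw [add_lie, map_add, h, h', add_zero]
    | smul c x _ h => rw [smul_lie, map_smul, h, smul_zero]
    | mem x hx =>
      induction hy using Submodule.span_induction with
      | zero => rw [lie_zero, map_zero]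
      | add x x' _ _ h h' => rw [lie_add, map_add, h, h', add_zero]
      | smul c x _ h => rw [lie_smul, map_smul, h, smul_zero]
      | mem y hy => exact hgen x hx y hy
  obtain ⟨ρ, h1, h2⟩ := exists_induced_action (nMinus b) (Submodule.span ℂ (borelGenerators b))
    hsplit φ hφ hscalar hbracket
  exact ⟨ρ, h1, fun h => by rw [h2, hφH], fun i hi x hx => by rw [h2, hφp i hi x hx]⟩

namespace Verma

variable (wt : Module.Dual ℂ H)

/-- The quotient map `U(𝔤) → Δ(wt)`. -/
def mk : 𝒰 𝔤 →ₗ[ℂ] Verma b wt := (vermaIdeal b wt).mkQ.restrictScalars ℂ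

theorem mk_surjective : Function.Surjective (mk b wt) := (vermaIdeal b wt).mkQ_surjective

theorem mk_ι_mul (x : 𝔤) (u : 𝒰 𝔤) : mk b wt (ιᵤ x * u) = ⁅x, mk b wt u⁆ := rfl

theorem mk_eq_zero {u : 𝒰 𝔤} : mk b wt u = 0 ↔ u ∈ vermaIdeal b wt :=
  Submodule.Quotient.mk_eq_zero _

/-- The canonical generator of a Verma module. -/
def gen : Verma b wt := mk b wt 1

theorem lie_gen (x : 𝔤) : ⁅x, gen b wt⁆ = mk b wt (ιᵤ x) := by
  rw [gen, ← mk_ι_mul, mul_one]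

theorem lie_gen_pos {i : H.root} (hi : b.IsPos i) {x : 𝔤} (hx : x ∈ rootSpace H (i.1 : H → ℂ)) :
    ⁅x, gen b wt⁆ = 0 := by
  rw [lie_gen, mk_eq_zero]
  exact Submodule.subset_span (Or.inl ⟨i, hi, x, hx, rfl⟩)

theorem gen_mem_wtSpace : gen b wt ∈ wtSpace H (Verma b wt) wt := by
  rw [mem_wtSpace]
  intro h
  rw [lie_gen, ← sub_eq_zero, gen, ← map_smul, ← map_sub, mk_eq_zero,
    ← Algebra.algebraMap_eq_smul_one]
  exact Submodule.subset_span (Or.inr ⟨h, rfl⟩)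

/-- A Verma module is generated by its highest weight vector over `U(𝔫₋)`. -/
theorem span_gen : Submodule.span (𝒰 (nMinus b)) {gen b wt} = ⊤ := by
  let v : Unit → Verma b wt := fun _ => gen b wt
  have himg : v '' Set.univ = {gen b wt} := by simp [v]
  let S := spanLie b (v := v) (κ := fun _ => wt) (fun _ => gen_mem_wtSpace b wt) Set.univ
    (fun j hj x hx i _ => by
      change ⁅x, gen b wt⁆ ∈ _
      rw [lie_gen_pos b wt hj hx]
      exact zero_mem _)
  rw [Submodule.eq_top_iff']
  intro m
  obtain ⟨u, rfl⟩ := mk_surjective b wt m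
  rw [← himg]
  change mk b wt u ∈ S
  induction u using env_induction with
  | one => exact Submodule.subset_span ⟨(), trivial, rfl⟩
  | add u v hu hv => rw [map_add]; exact add_mem hu hv
  | smul c u hu => rw [map_smul]; exact S.smul_mem c hu
  | mul x u hu => rw [mk_ι_mul]; exact S.lie_mem hu

/-- A Verma module is free over `U(𝔫₋)`. -/
theorem smul_gen_eq_zero {u : 𝒰 (nMinus b)} (h : u • gen b wt = 0) : u = 0 := by
  obtain ⟨ρ, h1, h2, h3⟩ := exists_verma_action b wt
  -- Thus `a ↦ ρ a 1` factors through `Δ(wt)`. By `key` it sends `u • gen` back to `u`, which gives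
  -- freeness.
  have hker : ∀ a ∈ vermaIdeal b wt, ρ a 1 = 0 := by
    intro a ha
    refine Submodule.span_induction (p := fun a _ => ρ a 1 = 0) ?_ ?_ ?_ ?_ ha
    · rintro a (⟨i, hi, x, hx, rfl⟩ | ⟨h, rfl⟩)
      · exact h3 i hi x hx
      · rw [map_sub, LinearMap.sub_apply, h2, AlgHom.commutes, Module.algebraMap_end_apply, sub_self]
    · simp
    · intro x y _ _ hx hy
      rw [map_add, LinearMap.add_apply, hx, hy, add_zero]
    · intro c x _ hx
      rw [smul_eq_mul, map_mul, Module.End.mul_apply, hx, map_zero]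
  have key : ∀ u : 𝒰 (nMinus b), ∃ a : 𝒰 𝔤, mk b wt a = u • gen b wt ∧ ρ a 1 = u := by
    intro u
    induction u using env_induction with
    | one => exact ⟨1, by rw [one_smul]; rfl, by simp⟩
    | add u v hu hv =>
      obtain ⟨a, ha, ha'⟩ := hu
      obtain ⟨c, hc, hc'⟩ := hv
      exact ⟨a + c, by rw [map_add, ha, hc, add_smul], by
        rw [map_add, LinearMap.add_apply, ha', hc']⟩
    | smul c u hu =>
      obtain ⟨a, ha, ha'⟩ := hu
      exact ⟨c • a, by rw [map_smul, ha, smul_assoc], by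
        rw [map_smul, LinearMap.smul_apply, ha']⟩
    | mul y u hu =>
      obtain ⟨a, ha, ha'⟩ := hu
      refine ⟨ιᵤ (y : 𝔤) * a, ?_, ?_⟩
      · rw [mk_ι_mul, ha, mul_smul, ι_smul]
        rfl
      · rw [map_mul, Module.End.mul_apply, ha', h1]
  obtain ⟨a, ha, ha'⟩ := key u
  rw [h, mk_eq_zero] at ha
  rw [← ha', hker a ha]

/-- The universal property of Verma modules. -/
theorem exists_hom {M : Type*} [AddCommGroup M] [Module ℂ M] [LieRingModule 𝔤 M]
    [LieModule ℂ 𝔤 M] {m : M} (hm : m ∈ wtSpace H M wt)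
    (hpos : ∀ i, b.IsPos i → ∀ x ∈ rootSpace H (i.1 : H → ℂ), ⁅x, m⁆ = 0) :
    ∃ f : Verma b wt →ₗ⁅ℂ, 𝔤⁆ M, f (gen b wt) = m := by
  let F : 𝒰 𝔤 →ₗ[𝒰 𝔤] M := LinearMap.toSpanSingleton (𝒰 𝔤) M m
  have hF : vermaIdeal b wt ≤ LinearMap.ker F := by
    refine Submodule.span_le.2 ?_
    rintro a (⟨i, hi, x, hx, rfl⟩ | ⟨h, rfl⟩)
    · change ιᵤ x • m = 0
      rw [ι_smul, hpos i hi x hx]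
    · change (ιᵤ (h : 𝔤) - algebraMap ℂ (𝒰 𝔤) (wt h)) • m = 0
      rw [sub_smul, ι_smul, algebraMap_smul, mem_wtSpace.1 hm h, sub_self]
  let F' : Verma b wt → M := (vermaIdeal b wt).liftQ F hF
  have hF' (u : 𝒰 𝔤) : F' (mk b wt u) = u • m := rfl
  refine ⟨{ toFun := fun v => F' v, map_add' := map_add ((vermaIdeal b wt).liftQ F hF), map_smul' := ?_, map_lie' := ?_ }, ?_⟩
  · intro c v
    obtain ⟨u, rfl⟩ := mk_surjective b wt v
    change F' (c • mk b wt u) = c • F' (mk b wt u)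
    rw [← map_smul, hF', hF', smul_assoc]
  · intro x v
    obtain ⟨u, rfl⟩ := mk_surjective b wt v
    rw [← mk_ι_mul, hF', hF', mul_smul, ι_smul]
  · change F' (mk b wt 1) = m
    rw [hF', one_smul]

end Verma

end VermaModules

end Weights

/-! ### Verma filtrations and finite `U(𝔫₋)`-bases of weight vectors. -/

section Filtrations

attribute [local instance] envModule envModule_isScalarTower

local notation "𝒰" => UniversalEnvelopingAlgebra ℂ
local notation "ιᵤ" => UniversalEnvelopingAlgebra.ι ℂ

variable {𝔤 : Type*} [LieRing 𝔤] [LieAlgebra ℂ 𝔤] [FiniteDimensional ℂ 𝔤]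
  [LieAlgebra.IsSemisimple ℂ 𝔤] {H : LieSubalgebra ℂ 𝔤} [H.IsCartanSubalgebra]
  {b : (IsKilling.rootSystem H).Base}
  {M : Type*} [AddCommGroup M] [Module ℂ M] [LieRingModule 𝔤 M] [LieModule ℂ 𝔤 M]

/-- Restriction of a homomorphism of `𝔤`-modules to `U(n)`. -/
def resEnv (n : LieSubalgebra ℂ 𝔤) {M' : Type*} [AddCommGroup M'] [Module ℂ M']
    [LieRingModule 𝔤 M'] [LieModule ℂ 𝔤 M'] (f : M →ₗ⁅ℂ, 𝔤⁆ M') : M →ₗ[𝒰 n] M' :=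
  envLinear (f : M →ₗ[ℂ] M') fun x m => by
    rw [ι_smul, ι_smul]
    exact f.map_lie x m

theorem map_env_smul {n : LieSubalgebra ℂ 𝔤} {M' : Type*} [AddCommGroup M'] [Module ℂ M']
    [LieRingModule 𝔤 M'] [LieModule ℂ 𝔤 M'] (f : M →ₗ⁅ℂ, 𝔤⁆ M') (u : 𝒰 n) (m : M) :
    f (u • m) = u • f m := (resEnv n f).map_smul u m

theorem LieSubmodule.env_smul_mem {n : LieSubalgebra ℂ 𝔤} (F : LieSubmodule ℂ 𝔤 M) (u : 𝒰 n) {m : M}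
    (hm : m ∈ F) : u • m ∈ F :=
  smul_mem_of_ι_smul_mem (p := F.toSubmodule) (fun x m hm => by rw [ι_smul]; exact F.lie_mem hm) u hm

/-- A finite `U(𝔫₋)`-basis of weight vectors, ordered compatibly with the weights, gives a Verma
filtration. -/
theorem hasVermaFiltration_of_sorted {n : ℕ} {v : Fin n → M} {κ : Fin n → Module.Dual ℂ H}
    (hv : ∀ i, v i ∈ wtSpace H M (κ i)) (hli : LinearIndependent (𝒰 (nMinus b)) v)
    (hspan : Submodule.span (𝒰 (nMinus b)) (Set.range v) = ⊤)
    (hsort : ∀ p, b.IsPos p → ∀ i j, WeightLE b (p.1.toLinear + κ i) (κ j) → j < i) :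
    HasVermaFiltration b M := by
  -- The weight of `⁅x, v i⁆` generates an upper set, and by `hsort` all generators with weights in
  -- that set come before `i`.
  have hpos : ∀ p, b.IsPos p → ∀ x ∈ rootSpace H (p.1 : H → ℂ), ∀ i,
      ⁅x, v i⁆ ∈ Submodule.span (𝒰 (nMinus b)) (v '' {k | k < i}) := by
    intro p hp x hx i
    have h := mem_span_of_mem_wtSpace hv hspan (U := {ν | WeightLE b (p.1.toLinear + κ i) ν})
      (fun μ ν hμν hμ => WeightLE.trans hμ hμν) (weightLE_refl _) (lie_mem_wtSpace_pos hx (hv i))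
    exact Submodule.span_mono (Set.image_mono fun k hk => hsort p hp i k hk) h
  let F : Fin (n + 1) → LieSubmodule ℂ 𝔤 M := fun j =>
    spanLie b hv {k | k.castSucc < j} fun p hp x hx i hi =>
      Submodule.span_mono (Set.image_mono fun k (hk : k < i) =>
        lt_trans (Fin.castSucc_lt_castSucc_iff.2 hk) hi) (hpos p hp x hx i)
  have hF (j : Fin (n + 1)) (m : M) :
      m ∈ F j ↔ m ∈ Submodule.span (𝒰 (nMinus b)) (v '' {k | k.castSucc < j}) := Iff.rfl
  have hFcs (i : Fin n) (m : M) :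
      m ∈ F i.castSucc ↔ m ∈ Submodule.span (𝒰 (nMinus b)) (v '' {k | k < i}) := Iff.rfl
  have hFsucc (i : Fin n) (m : M) : m ∈ F i.succ ↔
      ∃ a ∈ F i.castSucc, ∃ u : 𝒰 (nMinus b), m = a + u • v i := by
    have hset : {k : Fin n | k.castSucc < i.succ} = {k | k < i} ∪ {i} := by
      ext k
      simp only [Set.mem_ofPred_eq, Fin.castSucc_lt_succ_iff, Set.mem_union,
        Set.mem_singleton_iff]
      exact le_iff_lt_or_eq
    rw [hF, hset, Set.image_union, Submodule.span_union, Submodule.mem_sup, Set.image_singleton]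
    constructor
    · rintro ⟨a, ha, c, hc, rfl⟩
      obtain ⟨u, rfl⟩ := Submodule.mem_span_singleton.1 hc
      exact ⟨a, ha, u, rfl⟩
    · rintro ⟨a, ha, u, rfl⟩
      exact ⟨a, ha, _, Submodule.mem_span_singleton.2 ⟨u, rfl⟩, rfl⟩
  refine ⟨n, F, ?_, ?_, fun i => ⟨?_, κ i, ?_⟩⟩
  · rw [eq_bot_iff]
    intro m hm
    rw [hF] at hm
    have : {k : Fin n | k.castSucc < 0} = ∅ := by ext k; simp
    rw [this, Set.image_empty, Submodule.span_empty, Submodule.mem_bot] at hm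
    rw [hm]
    exact zero_mem _
  · rw [eq_top_iff]
    intro m _
    rw [hF]
    have : {k : Fin n | k.castSucc < Fin.last n} = Set.univ := by
      ext k; simp [Fin.castSucc_lt_last]
    rw [this, Set.image_univ, hspan]
    trivial
  · intro m hm
    exact (hFsucc i m).2 ⟨m, hm, 0, by rw [zero_smul, add_zero]⟩
  · set K := (F i.castSucc).comap (F i.succ).incl with hK
    have hvi : v i ∈ F i.succ := (hFsucc i _).2 ⟨0, zero_mem _, 1, by rw [one_smul, zero_add]⟩
    let w : F i.succ := ⟨v i, hvi⟩
    let π := LieSubmodule.Quotient.mk' K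
    have hπ (y : F i.succ) : π y = 0 ↔ (y : M) ∈ F i.castSucc :=
      LieSubmodule.Quotient.mk_eq_zero _
    have hw : w ∈ wtSpace H (F i.succ) (κ i) :=
      mem_wtSpace.2 fun h => Subtype.ext (mem_wtSpace.1 (hv i) h)
    -- By `hpos` the class of `v i` is a highest weight vector of the subquotient. The resulting map
    -- from the Verma module is injective by independence over `U(𝔫₋)` and surjective by `hFsucc`.
    obtain ⟨f, hf⟩ := Verma.exists_hom b (κ i) (map_mem_wtSpace π hw) (fun p hp x hx => by
      rw [← LieModuleHom.map_lie, hπ]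
      exact (hFcs i _).2 (hpos p hp x hx i))
    have hfu (u : 𝒰 (nMinus b)) : f (u • Verma.gen b (κ i)) = π (u • w) := by
      rw [map_env_smul, hf, ← map_env_smul]
    have hcoe (u : 𝒰 (nMinus b)) : ((u • w : F i.succ) : M) = u • v i :=
      map_env_smul (F i.succ).incl u w
    have hinj : Function.Injective f := by
      rw [injective_iff_map_eq_zero]
      intro z hz
      have : z ∈ Submodule.span (𝒰 (nMinus b)) {Verma.gen b (κ i)} := by
        rw [Verma.span_gen]; trivial
      obtain ⟨u, rfl⟩ := Submodule.mem_span_singleton.1 this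
      rw [hfu, hπ, hcoe, hFcs] at hz
      have hu : u = 0 := linearIndependent_iff_eq_zero_of_smul_mem_span.1 hli i u
        (Submodule.span_mono (Set.image_mono fun k (hk : k < i) =>
          Set.mem_sdiff_of_mem (Set.mem_univ k) hk.ne) hz)
      rw [hu, zero_smul]
    have hsurj : Function.Surjective f := by
      intro z
      obtain ⟨y, rfl⟩ := LieSubmodule.Quotient.surjective_mk' K z
      obtain ⟨a, ha, u, e⟩ := (hFsucc i y).1 y.2
      refine ⟨u • Verma.gen b (κ i), ?_⟩
      rw [hfu]
      change π (u • w) = π y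
      rw [← sub_eq_zero, ← map_sub, hπ]
      have : ((u • w - y : F i.succ) : M) = -a := by
        change ((u • w : F i.succ) : M) - (y : M) = -a
        rw [hcoe, e]
        abel
      rw [this]
      exact neg_mem ha
    let E := Equiv.ofBijective f ⟨hinj, hsurj⟩
    exact ⟨LieModuleEquiv.symm
      { f with
        invFun := E.symm
        left_inv := E.left_inv
        right_inv := E.right_inv }⟩

/-- Adding a positive root strictly raises the height, so sorting the basis by decreasing height
gives the order needed. -/
theorem hasVermaFiltration_of_basis {I : Type*} [Finite I] {v : I → M} {κ : I → Module.Dual ℂ H}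
    (hv : ∀ i, v i ∈ wtSpace H M (κ i)) (hli : LinearIndependent (𝒰 (nMinus b)) v)
    (hspan : Submodule.span (𝒰 (nMinus b)) (Set.range v) = ⊤) : HasVermaFiltration b M := by
  obtain ⟨n, ⟨e⟩⟩ := Finite.exists_equiv_fin I
  obtain ⟨f, hf⟩ := exists_height b
  -- Weights are arbitrary, so heights are complex; comparable weights differ by an integer height,
  -- so real parts suffice. The sign makes the increasing sort a decreasing one.
  let g : Fin n → ℝ := fun k => -(f (κ (e.symm k))).re
  let σ : Fin n ≃ I := (Tuple.sort g).trans e.symm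
  have hmono : ∀ i j, i ≤ j → (f (κ (σ j))).re ≤ (f (κ (σ i))).re := fun i j hij =>
    neg_le_neg_iff.1 (Tuple.monotone_sort g hij)
  refine hasVermaFiltration_of_sorted (v := v ∘ σ) (κ := κ ∘ σ) (fun i => hv _)
    (hli.comp _ σ.injective) (by rw [σ.surjective.range_comp, hspan]) fun p hp i j h => ?_
  by_contra hij
  have h1 := hmono i j (not_lt.1 hij)
  obtain ⟨m, hm, -⟩ := height_of_mem_closure hf h
  rw [Function.comp_apply, Function.comp_apply, map_sub, map_add, hf] at hm
  have h2 := congrArg Complex.re hm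
  simp only [Complex.sub_re, Complex.add_re, Complex.intCast_re, Complex.natCast_re] at h2
  have h3 : (0 : ℝ) < b.height p := by
    have : 0 < b.height p := hp
    exact_mod_cast this
  have h4 : (0 : ℝ) ≤ m := Nat.cast_nonneg m
  linarith

/-- A weight module with a Verma filtration has a finite `U(𝔫₋)`-basis of weight vectors. -/
theorem HasVermaFiltration.exists_basis (hM : IsWeightModule H M) (h : HasVermaFiltration b M) :
    ∃ (I : Type) (_ : Finite I) (v : I → M) (κ : I → Module.Dual ℂ H),
      (∀ i, v i ∈ wtSpace H M (κ i)) ∧ LinearIndependent (𝒰 (nMinus b)) v ∧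
      Submodule.span (𝒰 (nMinus b)) (Set.range v) = ⊤ := by
  obtain ⟨k, F, h0, hlast, hF⟩ := h
  have key : ∀ j : Fin (k + 1), ∃ (I : Type) (_ : Finite I) (v : I → M)
      (κ : I → Module.Dual ℂ H), (∀ i, v i ∈ wtSpace H M (κ i)) ∧
      LinearIndependent (𝒰 (nMinus b)) v ∧
      ∀ m, m ∈ Submodule.span (𝒰 (nMinus b)) (Set.range v) ↔ m ∈ F j := by
    intro j
    induction j using Fin.induction with
    | zero =>
      refine ⟨Empty, inferInstance, fun i => i.elim, fun i => i.elim, fun i => i.elim,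
        linearIndependent_empty_type, fun m => ?_⟩
      rw [h0, Set.range_eq_empty, Submodule.span_empty]
      exact Iff.rfl
    | succ j ih =>
      obtain ⟨I, _, v, κ, hv, hli, hspan⟩ := ih
      obtain ⟨hle, ν, ⟨e⟩⟩ := hF j
      set K := (F j.castSucc).comap (F j.succ).incl with hK
      let π := LieSubmodule.Quotient.mk' K
      have hπ (y : F j.succ) : π y = 0 ↔ (y : M) ∈ F j.castSucc :=
        LieSubmodule.Quotient.mk_eq_zero _
      obtain ⟨y, hy⟩ := LieSubmodule.Quotient.surjective_mk' K (e.symm (Verma.gen b ν))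
      have hyw : ∀ h : H, ⁅(h : 𝔤), (y : M)⁆ - ν h • (y : M) ∈ F j.castSucc := by
        intro h
        refine (hπ (⁅(h : 𝔤), y⁆ - ν h • y)).1 ?_
        change π y = _ at hy
        rw [map_sub, LieModuleHom.map_lie, map_smul, hy, ← LieModuleEquiv.coe_toLieModuleHom,
          ← LieModuleHom.map_lie, mem_wtSpace.1 (Verma.gen_mem_wtSpace b ν) h, map_smul, sub_self]
      -- `y` is a weight vector only modulo the previous step. The lift to a weight vector is taken
      -- along `M → M / F j`, since `M` is known to be a weight module; it differs from `y` by an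
      -- element of the previous step, so it stays in the filtration.
      let τ := LieSubmodule.Quotient.mk' (F j.castSucc)
      have hτ (m : M) : τ m = 0 ↔ m ∈ F j.castSucc := LieSubmodule.Quotient.mk_eq_zero _
      have hτy : τ y ∈ wtSpace H (M ⧸ F j.castSucc) ν := mem_wtSpace.2 fun h => by
        rw [← LieModuleHom.map_lie, ← map_smul, ← sub_eq_zero, ← map_sub, hτ]
        exact hyw h
      obtain ⟨m, hm, hmy⟩ := exists_wtSpace_lift τ
        (LieSubmodule.Quotient.surjective_mk' (F j.castSucc)) hM hτy
      rw [← sub_eq_zero, ← map_sub, hτ] at hmy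
      have hmF : m ∈ F j.succ := by
        have := add_mem (hle hmy) y.2
        rwa [sub_add_cancel] at this
      let w : F j.succ := ⟨m, hmF⟩
      have hw : e (π w) = Verma.gen b ν := by
        have h1 : π w = π y := by
          rw [← sub_eq_zero, ← map_sub, hπ]
          exact hmy
        have h2 : π y = e.symm (Verma.gen b ν) := hy
        rw [h1, h2, LieModuleEquiv.apply_symm_apply]
      have hcoe (u : 𝒰 (nMinus b)) : ((u • w : F j.succ) : M) = u • m :=
        map_env_smul (F j.succ).incl u w
      have heu (u : 𝒰 (nMinus b)) : e (π (u • w)) = u • Verma.gen b ν := by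
        have := map_env_smul (e.toLieModuleHom.comp π) u w
        rw [LieModuleHom.comp_apply, LieModuleHom.comp_apply] at this
        refine this.trans ?_
        rw [← hw]
        rfl
      -- Freeness of the Verma module makes the new vector independent of the earlier ones.
      have hzero (u : 𝒰 (nMinus b)) (hu : u • m ∈ F j.castSucc) : u = 0 := by
        rw [← hcoe, ← hπ] at hu
        have := heu u
        rw [hu, map_zero] at this
        exact Verma.smul_gen_eq_zero b ν this.symm
      refine ⟨I ⊕ Unit, inferInstance, Sum.elim v fun _ => m, Sum.elim κ fun _ => ν, ?_, ?_, ?_⟩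
      · rintro (i | _)
        · exact hv i
        · exact hm
      · rw [linearIndependent_sum]
        refine ⟨hli, ?_, ?_⟩
        · refine linearIndependent_iff_eq_zero_of_smul_mem_span.2 fun i a ha => hzero a ?_
          have hemp : Set.univ \ {i} = (∅ : Set Unit) := by ext x; simp
          rw [hemp, Set.image_empty, Submodule.span_empty, Submodule.mem_bot] at ha
          change a • m = 0 at ha
          rw [ha]
          exact zero_mem _
        · rw [Submodule.disjoint_def]
          intro x hx hx'
          have hr : Set.range ((Sum.elim v fun _ : Unit => m) ∘ Sum.inr) = {m} := by
            ext; simp [eq_comm]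
          rw [hr] at hx'
          obtain ⟨u, rfl⟩ := Submodule.mem_span_singleton.1 hx'
          rw [hzero u ((hspan _).1 hx), zero_smul]
      · intro x
        rw [Set.Sum.elim_range, Submodule.span_union, Submodule.mem_sup, Set.range_const]
        constructor
        · rintro ⟨a, ha, c, hc, rfl⟩
          obtain ⟨u, rfl⟩ := Submodule.mem_span_singleton.1 hc
          exact add_mem (hle ((hspan a).1 ha)) (LieSubmodule.env_smul_mem _ u hmF)
        · intro hx
          let x' : F j.succ := ⟨x, hx⟩
          have : e (π x') ∈ Submodule.span (𝒰 (nMinus b)) {Verma.gen b ν} := by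
            rw [Verma.span_gen]; trivial
          obtain ⟨u, hu⟩ := Submodule.mem_span_singleton.1 this
          rw [← heu, e.injective.eq_iff, ← sub_eq_zero, ← map_sub, hπ] at hu
          have hu' : u • m - x ∈ F j.castSucc := by
            rw [← hcoe]
            exact hu
          refine ⟨x - u • m, (hspan _).2 ?_, u • m, Submodule.mem_span_singleton.2 ⟨u, rfl⟩,
            sub_add_cancel _ _⟩
          rw [← neg_sub]
          exact neg_mem hu'
  obtain ⟨I, hI, v, κ, hv, hli, hspan⟩ := key (Fin.last k)
  refine ⟨I, hI, v, κ, hv, hli, ?_⟩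
  rw [Submodule.eq_top_iff']
  intro m
  rw [hspan, hlast]
  trivial

end Filtrations

/-! ### Weight generators for `𝒪`, tensor products and truncations. -/

section Truncation

attribute [local instance] envModule envModule_isScalarTower

local notation "𝒰" => UniversalEnvelopingAlgebra ℂ

variable {𝔤 : Type*} [LieRing 𝔤] [LieAlgebra ℂ 𝔤] [FiniteDimensional ℂ 𝔤]
  [LieAlgebra.IsSemisimple ℂ 𝔤] {H : LieSubalgebra ℂ 𝔤} [H.IsCartanSubalgebra]
  {b : (IsKilling.rootSystem H).Base}
  {M : Type*} [AddCommGroup M] [Module ℂ M] [LieRingModule 𝔤 M] [LieModule ℂ 𝔤 M]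

/-- A module in `𝒪` is generated over `U(𝔫₋)` by finitely many weight vectors. -/
theorem InO.exists_generators (hM : InO b M) :
    ∃ (I : Type) (_ : Finite I) (v : I → M) (κ : I → Module.Dual ℂ H),
      (∀ i, v i ∈ wtSpace H M (κ i)) ∧
      Submodule.span (𝒰 (nMinus b)) (Set.range v) = ⊤ := by
  classical
  let W : Set M := {m | ∃ μ, m ∈ wtSpace H M μ}
  have hW : Submodule.span (𝒰 (nMinus b)) W = ⊤ := by
    rw [Submodule.eq_top_iff']
    intro m
    have hle : ⨆ μ, wtSpace H M μ ≤ (Submodule.span (𝒰 (nMinus b)) W).restrictScalars ℂ :=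
      iSup_le fun μ m hm => Submodule.subset_span ⟨μ, hm⟩
    rw [isWeightModule_iff.1 hM.isWeightModule] at hle
    exact hle (x := m) trivial
  obtain ⟨s, hs⟩ := (hM.finite : Module.Finite (𝒰 (nMinus b)) M).fg_top
  -- Each member of a finite generating set involves only finitely many weight vectors; these
  -- replace it.
  have hsub : ∀ m : M, ∃ T : Finset M, ↑T ⊆ W ∧ m ∈ Submodule.span (𝒰 (nMinus b)) (T : Set M) :=
    fun m => Submodule.mem_span_finite_of_mem_span (by rw [hW]; trivial)
  choose T hTW hT using hsub
  let t : Finset M := s.biUnion T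
  have htW : ∀ m ∈ t, m ∈ W := fun m hm => by
    obtain ⟨m', -, hm'⟩ := Finset.mem_biUnion.1 hm
    exact hTW m' hm'
  have ht : Submodule.span (𝒰 (nMinus b)) (t : Set M) = ⊤ := by
    rw [eq_top_iff, ← hs, Submodule.span_le]
    intro m hm
    exact Submodule.span_mono (fun x hx => Finset.mem_biUnion.2 ⟨m, hm, hx⟩) (hT m)
  have hκ : ∀ i : Fin t.card, ∃ μ, (t.equivFin.symm i : M) ∈ wtSpace H M μ := fun i =>
    htW _ (t.equivFin.symm i).2
  choose κ hκ using hκ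
  refine ⟨Fin t.card, inferInstance, fun i => t.equivFin.symm i, κ, hκ, ?_⟩
  have hr : Set.range (fun i => (t.equivFin.symm i : M)) = t := by
    have := t.equivFin.symm.surjective.range_comp (Subtype.val : t → M)
    refine this.trans ?_
    simp
  rw [hr, ht]

theorem envFinite_of_span {I : Type*} [Finite I] {v : I → M}
    (hspan : Submodule.span (𝒰 (nMinus b)) (Set.range v) = ⊤) : EnvFinite (nMinus b) M := by
  have : Module.Finite (𝒰 (nMinus b)) M :=
    Module.finite_def.2 (hspan ▸ Submodule.fg_span (Set.finite_range v))
  exact this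

theorem tmul_mem_wtSpace {X : Type*} [AddCommGroup X] [Module ℂ X] [LieRingModule 𝔤 X]
    [LieModule ℂ 𝔤 X] {μ ν : Module.Dual ℂ H} {m : M} {x : X} (hm : m ∈ wtSpace H M μ)
    (hx : x ∈ wtSpace H X ν) : m ⊗ₜ[ℂ] x ∈ wtSpace H (M ⊗[ℂ] X) (μ + ν) := by
  rw [mem_wtSpace] at hm hx ⊢
  intro h
  rw [TensorProduct.LieModule.lie_tmul_right, hm h, hx h, LinearMap.add_apply, add_smul,
    TensorProduct.tmul_smul, ← TensorProduct.smul_tmul']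

/-! ### The restricted dual -/

variable (H) in
/-- The index type of a basis of weight vectors. -/
abbrev WeightIndex (N : Type*) [AddCommGroup N] [Module ℂ N] [LieRingModule 𝔤 N]
    [LieModule ℂ 𝔤 N] : Type _ :=
  Σ μ : Module.Dual ℂ H, Fin (Module.finrank ℂ (wtSpace H N μ))

theorem weightSpace_ne_bot {N : Type*} [AddCommGroup N] [Module ℂ N] [LieRingModule 𝔤 N]
    [LieModule ℂ 𝔤 N] {μ : Module.Dual ℂ H} (i : Fin (Module.finrank ℂ (wtSpace H N μ))) :
    (weightSpace N (μ : H → ℂ) : LieSubmodule ℂ H N) ≠ ⊥ := by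
  intro h
  have h' : wtSpace H N μ = ⊥ := by rw [wtSpace, h, LieSubmodule.bot_toSubmodule]
  have h0 : Module.finrank ℂ (wtSpace H N μ) = 0 := by rw [h', finrank_bot]
  exact absurd i.2 (by omega)

/-- The restricted dual of a module in `𝒪~` has a basis of weight vectors, only finitely many of
which have a weight below a given one. -/
theorem InOTilde.exists_dual_basis {N : Type*} [AddCommGroup N] [Module ℂ N] [LieRingModule 𝔤 N]
    [LieModule ℂ 𝔤 N] (hN : InOTilde b N) :
    ∃ (c : WeightIndex H N → restrictedDual H N) (κ : WeightIndex H N → Module.Dual ℂ H),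
      (∀ j, c j ∈ wtSpace H (restrictedDual H N) (κ j)) ∧ LinearIndependent ℂ c ∧
      Submodule.span ℂ (Set.range c) = ⊤ ∧ ∀ ξ, {j | WeightLE b (κ j) ξ}.Finite := by
  classical
  have hfd (μ : Module.Dual ℂ H) : FiniteDimensional ℂ (wtSpace H N μ) := hN.finiteDimensional μ
  have hint := DirectSum.isInternal_submodule_of_iSupIndep_of_iSup_eq_top
    (iSupIndep_wtSpace H N) (isWeightModule_iff.1 hN.isWeightModule)
  -- The coordinate functionals of a basis adapted to the weight spaces have the opposite weights.
  -- They span the restricted dual because a functional in it is nonzero on finitely many weight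
  -- spaces, each of finite dimension.
  let B := hint.collectedBasis fun μ => Module.finBasis ℂ (wtSpace H N μ)
  have hB (j) : B j ∈ wtSpace H N j.1 := hint.collectedBasis_mem _ j
  have hcoord (j : WeightIndex H N) : B.coord j ∈ restrictedDual H N := by
    change Set.Finite _
    refine (Set.finite_singleton j.1).subset ?_
    rintro μ ⟨m, hm, hne⟩
    by_contra h
    exact hne (hint.collectedBasis_repr_of_mem_ne (fun μ => Module.finBasis ℂ (wtSpace H N μ)) h hm)
  have hfin (S : Set (Module.Dual ℂ H)) (hS : S.Finite) : {j : WeightIndex H N | j.1 ∈ S}.Finite := by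
    refine (hS.toFinset.sigma fun _ => Finset.univ).finite_toSet.subset fun j hj => ?_
    simpa using (show j.1 ∈ S from hj)
  let c : WeightIndex H N → restrictedDual H N := fun j => ⟨B.coord j, hcoord j⟩
  refine ⟨c, fun j => -j.1, fun j => ?_, ?_, ?_, fun ξ => ?_⟩
  · rw [mem_wtSpace]
    intro h
    refine Subtype.ext (B.ext fun k => ?_)
    change ⁅(h : 𝔤), B.coord j⁆ (B k) = -(j.1 h) • B.coord j (B k)
    have hlie (f : Module.Dual ℂ N) (m : N) : ⁅(h : 𝔤), f⁆ m = -f ⁅(h : 𝔤), m⁆ := by simp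
    rw [hlie, mem_wtSpace.1 (hB k) h, map_smul, Module.Basis.coord_apply,
      Module.Basis.repr_self, Finsupp.single_apply]
    by_cases hkj : k = j
    · subst hkj; simp
    · simp [hkj]
  · refine LinearIndependent.of_comp (restrictedDual H N).toSubmodule.subtype ?_
    exact B.linearIndependent_coord
  · rw [Submodule.eq_top_iff']
    rintro ⟨f, hf⟩
    have hf' : {j : WeightIndex H N | f (B j) ≠ 0}.Finite := (hfin _ hf).subset fun j hj => ⟨B j, hB j, hj⟩
    have : (⟨f, hf⟩ : restrictedDual H N) = ∑ j ∈ hf'.toFinset, f (B j) • c j := by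
      refine Subtype.ext (B.ext fun k => ?_)
      have h1 : ((∑ j ∈ hf'.toFinset, f (B j) • c j : restrictedDual H N) : Module.Dual ℂ N) =
          ∑ j ∈ hf'.toFinset, f (B j) • B.coord j :=
        map_sum (restrictedDual H N).toSubmodule.subtype _ _
      rw [h1, LinearMap.sum_apply]
      have h2 : ∀ j, (f (B j) • B.coord j) (B k) = if k = j then f (B j) else 0 := fun j => by
        rw [LinearMap.smul_apply, Module.Basis.coord_apply, Module.Basis.repr_self,
          Finsupp.single_apply, smul_eq_mul, mul_ite, mul_one, mul_zero]
      simp only [h2, Finset.sum_ite_eq, Set.Finite.mem_toFinset]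
      by_cases hk : f (B k) = 0
      · simp [hk]
      · exact (if_pos hk).symm
    rw [this]
    exact Submodule.sum_mem _ fun j _ => Submodule.smul_mem _ _ (Submodule.subset_span ⟨j, rfl⟩)
  · obtain ⟨S, hS⟩ := hN.support_le
    -- A weight `μ ≤ ν` of `N` gives `-ν ≤ -μ`, so the dual weights below `ξ` lie in finitely many
    -- finite intervals.
    have hint : (⋃ ν ∈ S, {η | WeightLE b (-ν) η ∧ WeightLE b η ξ}).Finite :=
      S.finite_toSet.biUnion fun ν _ => finite_weightLE_interval (-ν) ξ
    refine (hfin _ (hint.preimage (f := fun μ => -μ) neg_injective.injOn)).subset fun j hj => ?_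
    obtain ⟨ν, hν, hle⟩ := hS j.1 (weightSpace_ne_bot j.2)
    refine Set.mem_biUnion hν ⟨?_, hj⟩
    rw [WeightLE] at hle ⊢
    rwa [neg_sub_neg]

/-! ### Truncations of modules generated by weight vectors -/

section

variable {I : Type*} {v : I → M} {κ : I → Module.Dual ℂ H}

/-- The weights `≰ wt` form an upper set. So the span on the right contains all their weight spaces
and is stable under positive root vectors, hence under `𝔤`. -/
theorem mem_truncSubmodule_iff (wt : Module.Dual ℂ H) (hv : ∀ i, v i ∈ wtSpace H M (κ i))
    (hspan : Submodule.span (𝒰 (nMinus b)) (Set.range v) = ⊤) {m : M} :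
    m ∈ truncSubmodule b wt M ↔
      m ∈ Submodule.span (𝒰 (nMinus b)) (v '' {i | ¬ WeightLE b (κ i) wt}) := by
  have hU : ∀ μ ν, WeightLE b μ ν → μ ∈ {μ | ¬ WeightLE b μ wt} → ν ∈ {μ | ¬ WeightLE b μ wt} :=
    fun μ ν hμν hμ hν => hμ (hμν.trans hν)
  constructor
  · have hle : truncSubmodule b wt M ≤ spanLie b hv {i | ¬ WeightLE b (κ i) wt}
        fun p hp x hx i hi => mem_span_of_mem_wtSpace hv hspan hU
          (hU _ _ (weightLE_add_root hp _) hi) (lie_mem_wtSpace_pos hx (hv i)) := by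
      refine LieSubmodule.lieSpan_le.2 ?_
      rintro m ⟨μ, hμ, hm⟩
      exact mem_span_of_mem_wtSpace hv hspan hU hμ hm
    exact fun hm => hle hm
  · intro hm
    let P := envSubmodule (L := nMinus b) (truncSubmodule b wt M).toSubmodule
      fun x m hm => (truncSubmodule b wt M).lie_mem (x := (x : 𝔤)) hm
    have hle : Submodule.span (𝒰 (nMinus b)) (v '' {i | ¬ WeightLE b (κ i) wt}) ≤ P := by
      rw [Submodule.span_le]
      rintro _ ⟨i, hi, rfl⟩
      exact LieSubmodule.subset_lieSpan ⟨κ i, hi, hv i⟩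
    exact hle hm

variable (b v κ) in
/-- The images in the truncation of the generators of weight `≤ wt`. -/
def truncGenerators (wt : Module.Dual ℂ H) : {i // WeightLE b (κ i) wt} → Trunc b wt M :=
  fun i => LieSubmodule.Quotient.mk' (truncSubmodule b wt M) (v i)

theorem truncGenerators_mem (wt : Module.Dual ℂ H) (hv : ∀ i, v i ∈ wtSpace H M (κ i))
    (i : {i // WeightLE b (κ i) wt}) :
    truncGenerators b v κ wt i ∈ wtSpace H (Trunc b wt M) (κ i) :=
  map_mem_wtSpace _ (hv i)

theorem span_truncGenerators (wt : Module.Dual ℂ H) (hv : ∀ i, v i ∈ wtSpace H M (κ i))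
    (hspan : Submodule.span (𝒰 (nMinus b)) (Set.range v) = ⊤) :
    Submodule.span (𝒰 (nMinus b)) (Set.range (truncGenerators b v κ wt)) = ⊤ := by
  let π := resEnv (nMinus b) (LieSubmodule.Quotient.mk' (truncSubmodule b wt M))
  have hπ : Function.Surjective π := LieSubmodule.Quotient.surjective_mk' _
  have h : (Submodule.span (𝒰 (nMinus b)) (Set.range v)).map π = ⊤ := by
    rw [hspan, Submodule.map_top, LinearMap.range_eq_top]
    exact hπ
  rw [eq_top_iff, ← h, Submodule.map_span, Submodule.span_le]
  rintro _ ⟨_, ⟨i, rfl⟩, rfl⟩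
  by_cases hi : WeightLE b (κ i) wt
  · exact Submodule.subset_span ⟨⟨i, hi⟩, rfl⟩
  · have : π (v i) = 0 := (LieSubmodule.Quotient.mk_eq_zero _).2
      (LieSubmodule.subset_lieSpan ⟨κ i, hi, hv i⟩)
    rw [this]
    exact zero_mem _

/-- The kernel of the truncation is spanned by the complementary part of the basis, so the rest
stays independent. -/
theorem linearIndependent_truncGenerators (wt : Module.Dual ℂ H)
    (hv : ∀ i, v i ∈ wtSpace H M (κ i)) (hli : LinearIndependent (𝒰 (nMinus b)) v)
    (hspan : Submodule.span (𝒰 (nMinus b)) (Set.range v) = ⊤) :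
    LinearIndependent (𝒰 (nMinus b)) (truncGenerators b v κ wt) := by
  let π := resEnv (nMinus b) (LieSubmodule.Quotient.mk' (truncSubmodule b wt M))
  refine (hli.comp _ Subtype.val_injective).map (f := π) ?_
  have hker : LinearMap.ker π =
      Submodule.span (𝒰 (nMinus b)) (v '' {i | ¬ WeightLE b (κ i) wt}) := by
    ext m
    rw [← mem_truncSubmodule_iff wt hv hspan, LinearMap.mem_ker]
    exact LieSubmodule.Quotient.mk_eq_zero _
  rw [hker, Set.range_comp, Subtype.range_coe_subtype]
  exact hli.disjoint_span_image (Set.disjoint_left.2 fun i hi hi' => hi' hi)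

end

/-- For each of the finitely many `i`, the condition says `κ' j ≤ wt - κ i`. This is what makes the
truncation finitely generated although the restricted dual may be infinite-dimensional. -/
theorem finite_weightLE_add {I J : Type*} [Finite I] {κ : I → Module.Dual ℂ H}
    {κ' : J → Module.Dual ℂ H} (h : ∀ ξ, {j | WeightLE b (κ' j) ξ}.Finite) (wt : Module.Dual ℂ H) :
    Finite {p : I × J // WeightLE b (κ p.1 + κ' p.2) wt} := by
  have hfin : (⋃ i, Prod.mk i '' {j | WeightLE b (κ' j) (wt - κ i)} : Set (I × J)).Finite :=
    Set.finite_iUnion fun i => (h _).image _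
  have hsub : {p : I × J | WeightLE b (κ p.1 + κ' p.2) wt} ⊆
      ⋃ i, Prod.mk i '' {j | WeightLE b (κ' j) (wt - κ i)} := by
    intro p hp
    refine Set.mem_iUnion.2 ⟨p.1, p.2, ?_, rfl⟩
    change WeightLE b (κ p.1 + κ' p.2) wt at hp
    change WeightLE b (κ' p.2) (wt - κ p.1)
    rw [WeightLE] at hp ⊢
    rwa [sub_sub]
  exact (hfin.subset hsub).to_subtype

theorem InO.trunc_tensor_dual {N : Type*} [AddCommGroup N] [Module ℂ N] [LieRingModule 𝔤 N]
    [LieModule ℂ 𝔤 N] (hN : InOTilde b N) (wt : Module.Dual ℂ H) (hM : InO b M) :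
    InO b (Trunc b wt (M ⊗[ℂ] restrictedDual H N)) := by
  obtain ⟨I, _, v, κ, hv, hspan⟩ := hM.exists_generators
  obtain ⟨c, κ', hc, -, hcspan, hfin⟩ := hN.exists_dual_basis
  have := finite_weightLE_add (κ := κ) hfin wt
  have hw (p : I × WeightIndex H N) := tmul_mem_wtSpace (hv p.1) (hc p.2)
  have hs := span_truncGenerators wt hw (span_tmul_eq_top hspan hcspan)
  exact ⟨isWeightModule_of_span (truncGenerators_mem wt hw) hs, envFinite_of_span hs⟩

theorem InFDelta.trunc_tensor_dual {N : Type*} [AddCommGroup N] [Module ℂ N] [LieRingModule 𝔤 N]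
    [LieModule ℂ 𝔤 N] (hN : InOTilde b N) (wt : Module.Dual ℂ H) (hM : InFDelta b M) :
    HasVermaFiltration b (Trunc b wt (M ⊗[ℂ] restrictedDual H N)) ∧
      EnvFree (nMinus b) (Trunc b wt (M ⊗[ℂ] restrictedDual H N)) := by
  obtain ⟨I, _, v, κ, hv, hli, hspan⟩ :=
    hM.hasVermaFiltration.exists_basis hM.inO.isWeightModule
  obtain ⟨c, κ', hc, hcli, hcspan, hfin⟩ := hN.exists_dual_basis
  have := finite_weightLE_add (κ := κ) hfin wt
  have hw (p : I × WeightIndex H N) := tmul_mem_wtSpace (hv p.1) (hc p.2)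
  have ht := span_tmul_eq_top hspan hcspan
  have hs := span_truncGenerators wt hw ht
  have hl := linearIndependent_truncGenerators wt hw (linearIndependent_tmul hli hspan hcli) ht
  exact ⟨hasVermaFiltration_of_basis (truncGenerators_mem wt hw) hl hs,
    Module.Free.of_basis (Module.Basis.mk hl hs.ge)⟩

end Truncation

end CatO

end

theorem proposition2p9 {𝔤 : Type*} [LieRing 𝔤] [LieAlgebra ℂ 𝔤] [FiniteDimensional ℂ 𝔤]
    [LieAlgebra.IsSemisimple ℂ 𝔤] (H : LieSubalgebra ℂ 𝔤) [H.IsCartanSubalgebra]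
    (b : (LieAlgebra.IsKilling.rootSystem H).Base)
    (M : Type*) [AddCommGroup M] [Module ℂ M] [LieRingModule 𝔤 M] [LieModule ℂ 𝔤 M]
    (N : Type*) [AddCommGroup N] [Module ℂ N] [LieRingModule 𝔤 N] [LieModule ℂ 𝔤 N]
    (hN : CatO.InOTilde b N) (wt : Module.Dual ℂ H) :
    (CatO.InFDelta b M →
      CatO.InFDelta b (CatO.Trunc b wt (M ⊗[ℂ] CatO.restrictedDual H N)) ∧
      CatO.EnvFinite (CatO.nMinus b) (CatO.Trunc b wt (M ⊗[ℂ] CatO.restrictedDual H N)) ∧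
      CatO.EnvFree (CatO.nMinus b) (CatO.Trunc b wt (M ⊗[ℂ] CatO.restrictedDual H N))) ∧
    (CatO.InO b M →
      CatO.InO b (CatO.Trunc b wt (M ⊗[ℂ] CatO.restrictedDual H N))) :=
  ⟨fun hM =>
    have hO := hM.inO.trunc_tensor_dual hN wt
    have hF := hM.trunc_tensor_dual hN wt
    ⟨⟨hO, hF.1⟩, hO.finite, hF.2⟩, fun hM => hM.trunc_tensor_dual hN wt⟩
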